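/- Let $X_1,X_2,\dots$ be i.i.d. real random variables with common characteristic function $\varphi_X(t)=\mathbb E\,e^{itX_1}$, let $S_n=\sum_{i=1}^n X_i$, and let $b\in\mathbb R$. The following are equivalent. (i) $\dfrac{S_n}{n}-b\log n$ converges in distribution, as $n\to\infty$, to some non-degenerate (i.e. not almost surely constant) real random variable $Z$. (ii) There are real numbers $\kappa>0$ and $\lambda$ such that $$\varphi_X(t)=1-(\kappa-i\lambda)t-ibt\log t+o(t)\qquad\text{as } t\downarrow 0 .$$ Moreover, whenever (ii) holds with given $\kappa>0$ and $\lambda$, the limit $Z$ in (i) is $1$-stable and has characteristic function $$\varphi_Z(t)=\exp\bigl(-(\kappa-i\lambda)t-ibt\log t\bigr),\qquad t>0,$$ and $|b|\le 2\kappa/\pi$. Here a real random variable $Z$ is called $1$-stable if it is non-degenerate and there are real constants $d_n$ such that, for every $n\ge1$, if $Z_1,\dots,Z_n$ are independent copies of $Z$, then $Z_1+\dots+Z_n$ has the same distribution as $nZ+d_n$. -/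

import Mathlib

universe u v

open MeasureTheory ProbabilityTheory Filter Topology Asymptotics

/-- A real random variable `Z` on `(Ω, P)` is non-degenerate if it is not almost surely constant. -/
def NonDegenerate {Ω : Type*} [MeasurableSpace Ω] (Z : Ω → ℝ) (P : Measure Ω) : Prop :=
  ¬ ∃ c : ℝ, ∀ᵐ ω ∂P, Z ω = c

/-- A probability distribution `ν` on `ℝ` is `α`-stable (stable with index `α ∈ (0, 2]`) if it is
not a point mass and there are real constants `d n` such that, for every `n ≥ 1`, the sum of `n`
independent variables with distribution `ν` has the same distribution as `n ^ (1 / α) * x + d n`,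
where `x` has distribution `ν`. -/
def IsStableLaw (α : ℝ) (ν : Measure ℝ) : Prop :=
  0 < α ∧ α ≤ 2 ∧ IsProbabilityMeasure ν ∧ NonDegenerate (fun x : ℝ => x) ν ∧
    ∃ d : ℕ → ℝ, ∀ n : ℕ, 1 ≤ n →
      (Measure.pi (fun _ : Fin n => ν)).map (fun x => ∑ i, x i) =
        ν.map (fun x => (n : ℝ) ^ (1 / α) * x + d n)

/-- The expansion `φ(t) = 1 - (κ - iλ) t - i b t log t + o(t)` as `t ↓ 0`. -/
def HasLogExpansion (φ : ℝ → ℂ) (b κ l : ℝ) : Prop :=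
  (fun t : ℝ => φ t - (1 - ((κ : ℂ) - Complex.I * l) * t - Complex.I * b * t * (Real.log t : ℂ)))
    =o[𝓝[>] (0 : ℝ)] (fun t : ℝ => t)

/-! The characteristic function of `S_n / n - b log n` is `φ(t/n)^n exp(-i t b log n)`. The function
`expo c b` satisfies `expo c b t = n * expo c b (t/n) - i t b log n`, so `exp (expo c b t)` is a
fixed point of this normalisation. Everything compares `log φ` with `expo c b` near `0`, where `c =
-(κ - iλ)`.

(ii) ⇒ (i): an `o(t)` error in `log φ`, multiplied by `n` at `t/n`, vanishes
(`tendsto_pow_mul_exp`). Lévy's theorem then supplies the limit law, which is non-degenerate since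
its characteristic function has modulus `e^(-κt) < 1`.

(i) ⇒ (ii): comparing indices `n` and `kn` gives a scaling relation for the limit, whose continuous
solutions are `exp (expo c b)` (`eq_exp_expo_of_scaling`). Non-degeneracy forces `Re c < 0`. Weak
convergence makes the convergence of characteristic functions uniform on `[0, 1]`, which recovers
the expansion at every small `s`, not only along `t/n` (`log_sub_expo_isLittleO`).

The inequality on `b` uses the law `μ` of `X_1`. Laplace transforms of `φ` show that `∫ x²/(x²+s²)
dμ` is at most about `κ/s`, and that `∫ u²x/(u²+x²) dμ = b log u + O(1)`. By `abs_kernel_sub_le`,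
the increment of the second kernel over `[1, V]` is at most `2/π` times the integral of the first,
up to boundary terms. Comparing the coefficients of `log V` gives the claim. -/

namespace LogStable

/-! ### The exponent and first-order comparison of `log` and `exp`. -/

/-- The exponent `c t - i b t log t`. -/
noncomputable def expo (c : ℂ) (b t : ℝ) : ℂ :=
  c * t - Complex.I * b * t * (Real.log t : ℂ)

lemma continuous_expo (c : ℂ) (b : ℝ) : Continuous (expo c b) := by
  have h : expo c b = fun t : ℝ => c * t - Complex.I * b * ((t * Real.log t : ℝ) : ℂ) := by
    funext t; simp only [expo]; push_cast; ring
  rw [h]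
  have := Real.continuous_mul_log
  fun_prop

@[simp] lemma expo_zero (c : ℂ) (b : ℝ) : expo c b 0 = 0 := by simp [expo]

/-- The drift `b log k` created by dilation is exactly what the centring `b log n` compensates. -/
lemma expo_mul (c : ℂ) (b : ℝ) {k t : ℝ} (hk : 0 < k) (ht : 0 < t) :
    expo c b (k * t) = k * expo c b t - Complex.I * (k * t) * b * (Real.log k : ℂ) := by
  simp only [expo, Real.log_mul hk.ne' ht.ne']
  push_cast
  ring

/-- Factoring out `√t` leaves a quantity tending to `0`. This makes second-order errors of `log` and
`exp` negligible against `t`. -/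
lemma expo_sq_isLittleO (c : ℂ) (b : ℝ) :
    (fun t : ℝ => ‖expo c b t‖ ^ 2) =o[𝓝[>] 0] (fun t : ℝ => t) := by
  have h1 : Tendsto (fun t : ℝ => ‖c‖ * Real.sqrt t + |b| * |Real.log t * t ^ (1 / 2 : ℝ)|)
      (𝓝[>] 0) (𝓝 0) := by
    have hs : Tendsto (fun t : ℝ => Real.sqrt t) (𝓝[>] 0) (𝓝 0) := by
      have := (Real.continuous_sqrt.tendsto 0).mono_left (nhdsWithin_le_nhds (s := Set.Ioi 0))
      simpa using this
    have hl := (tendsto_log_mul_rpow_nhdsGT_zero (r := 1 / 2) (by norm_num)).abs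
    simpa using (hs.const_mul ‖c‖).add (hl.const_mul |b|)
  have h2 := h1.pow 2
  rw [isLittleO_iff]
  intro ε hε
  have h3 := h2.eventually (Iio_mem_nhds (by simpa using hε : (0:ℝ) ^ 2 < ε))
  filter_upwards [h3, self_mem_nhdsWithin] with t ht ht0
  have ht0 : 0 < t := ht0
  have hb : ‖expo c b t‖ ≤
      (‖c‖ * Real.sqrt t + |b| * |Real.log t * t ^ (1 / 2 : ℝ)|) * Real.sqrt t := by
    have hst : Real.sqrt t * Real.sqrt t = t := Real.mul_self_sqrt ht0.le
    have hss : t ^ (1 / 2 : ℝ) = Real.sqrt t := (Real.sqrt_eq_rpow t).symm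
    calc ‖expo c b t‖ ≤ ‖c * t‖ + ‖Complex.I * b * t * (Real.log t : ℂ)‖ := norm_sub_le _ _
      _ = ‖c‖ * t + |b| * t * |Real.log t| := by
        simp [abs_of_pos ht0]
      _ = ‖c‖ * (Real.sqrt t * Real.sqrt t)
            + |b| * (Real.sqrt t * Real.sqrt t) * |Real.log t| := by rw [hst]
      _ = _ := by rw [hss, abs_mul, abs_of_nonneg (Real.sqrt_nonneg t)]; ring
  have h4 : ‖expo c b t‖ ^ 2 ≤ ε * t := by
    calc ‖expo c b t‖ ^ 2 ≤ ((‖c‖ * Real.sqrt t + |b| * |Real.log t * t ^ (1 / 2 : ℝ)|)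
          * Real.sqrt t) ^ 2 := by gcongr
      _ = (‖c‖ * Real.sqrt t + |b| * |Real.log t * t ^ (1 / 2 : ℝ)|) ^ 2 * t := by
        rw [mul_pow, Real.sq_sqrt ht0.le]
      _ ≤ ε * t := by gcongr
  simpa [abs_of_pos ht0] using h4

lemma tendsto_expo_nhdsGT (c : ℂ) (b : ℝ) : Tendsto (expo c b) (𝓝[>] 0) (𝓝 0) := by
  simpa using ((continuous_expo c b).tendsto 0).mono_left nhdsWithin_le_nhds

/-- A continuous path from `0` whose exponential stays close to `1` stays close to `0`. -/
lemma norm_le_of_norm_exp_sub_one_lt {D : ℝ → ℂ} {T : ℝ} (hD : ContinuousOn D (Set.Icc 0 T))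
    (h0 : D 0 = 0) (h : ∀ t ∈ Set.Icc 0 T, ‖Complex.exp (D t) - 1‖ < 1 / 4) {t : ℝ}
    (ht : t ∈ Set.Icc 0 T) : ‖D t‖ ≤ 2 * ‖Complex.exp (D t) - 1‖ := by
  have key : ∀ z : ℂ, ‖z‖ ≤ 1 / 2 → ‖z‖ ≤ 2 * ‖Complex.exp z - 1‖ := by
    intro z hz
    have h1 := Complex.norm_exp_sub_one_sub_id_le (x := z) (by linarith)
    have h2 : ‖z‖ ≤ ‖Complex.exp z - 1‖ + ‖Complex.exp z - 1 - z‖ := by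
      have := norm_sub_le (Complex.exp z - 1) (Complex.exp z - 1 - z)
      simpa using this
    nlinarith [norm_nonneg z]
  by_cases hlt : ‖D t‖ ≤ 1 / 2
  · exact key _ hlt
  · exfalso
    push Not at hlt
    have hc : ContinuousOn (fun s => ‖D s‖) (Set.Icc 0 t) :=
      (hD.mono (Set.Icc_subset_Icc_right ht.2)).norm
    have hiv := intermediate_value_Icc ht.1 hc
    -- Where the norm equals `1/2`, `key` forces `‖exp - 1‖ ≥ 1/4`, which the hypothesis excludes.
    obtain ⟨s, hs, hs2⟩ := hiv (show (1 / 2 : ℝ) ∈ _ by simp [h0]; norm_num at hlt ⊢; exact hlt.le)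
    simp only at hs2
    have h1 := key (D s) hs2.le
    have h2 := h s ⟨hs.1, hs.2.trans ht.2⟩
    linarith

/-- The error `log φ - (φ - 1)` is `O(‖φ - 1‖²)`, and `‖φ - 1‖²` is controlled by `‖ψ‖²` and the
square of an `o(t)`. -/
lemma log_sub_isLittleO_of_sub_one_add {φ ψ : ℝ → ℂ} (hφ : Tendsto φ (𝓝[>] 0) (𝓝 1))
    (hψ : (fun t : ℝ => ‖ψ t‖ ^ 2) =o[𝓝[>] 0] (fun t : ℝ => t))
    (h : (fun t : ℝ => φ t - (1 + ψ t)) =o[𝓝[>] 0] (fun t : ℝ => t)) :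
    (fun t : ℝ => Complex.log (φ t) - ψ t) =o[𝓝[>] 0] (fun t : ℝ => t) := by
  have hid : (fun t : ℝ => t ^ 2) =o[𝓝[>] 0] (fun t : ℝ => t) := by
    have : (fun t : ℝ => t ^ 2) =o[𝓝 0] (fun t : ℝ => t ^ 1) := isLittleO_pow_pow one_lt_two
    simpa using this.mono nhdsWithin_le_nhds
  have hsq : (fun t : ℝ => ‖φ t - 1‖ ^ 2) =o[𝓝[>] 0] (fun t : ℝ => t) := by
    have h1 : (fun t : ℝ => 2 * ‖φ t - (1 + ψ t)‖ ^ 2 + 2 * ‖ψ t‖ ^ 2) =o[𝓝[>] 0]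
        (fun t : ℝ => t) := by
      refine IsLittleO.add ?_ (hψ.const_mul_left 2)
      exact (((h.norm_left).isBigO.pow 2).trans_isLittleO hid).const_mul_left 2
    refine IsBigO.trans_isLittleO (IsBigO.of_bound 1 (Eventually.of_forall fun t => ?_)) h1
    have h2 : ‖φ t - 1‖ ≤ ‖φ t - (1 + ψ t)‖ + ‖ψ t‖ := by
      have := norm_add_le (φ t - (1 + ψ t)) (ψ t)
      rwa [show φ t - (1 + ψ t) + ψ t = φ t - 1 by ring] at this
    rw [one_mul, Real.norm_of_nonneg (by positivity), Real.norm_of_nonneg (by positivity)]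
    nlinarith [norm_nonneg (φ t - 1), sq_nonneg (‖φ t - (1 + ψ t)‖ - ‖ψ t‖)]
  have hlog : (fun t : ℝ => Complex.log (φ t) - (φ t - 1)) =o[𝓝[>] 0] (fun t : ℝ => t) := by
    refine IsBigO.trans_isLittleO (IsBigO.of_bound 1 ?_) hsq
    have hn : Tendsto (fun t => ‖φ t - 1‖) (𝓝[>] 0) (𝓝 0) := by
      simpa using (hφ.sub_const 1).norm
    filter_upwards [hn.eventually (Iio_mem_nhds (by norm_num : (0:ℝ) < 1 / 2))] with t ht
    have ht : ‖φ t - 1‖ < 1 / 2 := ht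
    have h1 := Complex.norm_log_one_add_sub_self_le (z := φ t - 1) (by linarith)
    rw [add_sub_cancel] at h1
    have h3 : (1 - ‖φ t - 1‖)⁻¹ ≤ 2 := by
      rw [inv_le_comm₀ (by linarith) (by norm_num)]; linarith
    rw [one_mul, Real.norm_of_nonneg (by positivity)]
    nlinarith [sq_nonneg ‖φ t - 1‖]
  refine (hlog.add h).congr_left fun t => ?_
  ring

lemma sub_one_add_isLittleO_of_log_sub {φ ψ : ℝ → ℂ} (hφ : Tendsto φ (𝓝[>] 0) (𝓝 1))
    (hψ0 : Tendsto ψ (𝓝[>] 0) (𝓝 0))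
    (hψ : (fun t : ℝ => ‖ψ t‖ ^ 2) =o[𝓝[>] 0] (fun t : ℝ => t))
    (h : (fun t : ℝ => Complex.log (φ t) - ψ t) =o[𝓝[>] 0] (fun t : ℝ => t)) :
    (fun t : ℝ => φ t - (1 + ψ t)) =o[𝓝[>] 0] (fun t : ℝ => t) := by
  have hid : Tendsto (fun t : ℝ => t) (𝓝[>] 0) (𝓝 0) := nhdsWithin_le_nhds
  have hid2 : (fun t : ℝ => t ^ 2) =o[𝓝[>] 0] (fun t : ℝ => t) := by
    have : (fun t : ℝ => t ^ 2) =o[𝓝 0] (fun t : ℝ => t ^ 1) := isLittleO_pow_pow one_lt_two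
    simpa using this.mono nhdsWithin_le_nhds
  have hl : Tendsto (fun t => Complex.log (φ t)) (𝓝[>] 0) (𝓝 0) := by
    have h1 := (h.isBigO.trans_tendsto hid).add hψ0
    simpa using h1
  have hsq : (fun t : ℝ => ‖Complex.log (φ t)‖ ^ 2) =o[𝓝[>] 0] (fun t : ℝ => t) := by
    have h1 : (fun t : ℝ => 2 * ‖Complex.log (φ t) - ψ t‖ ^ 2 + 2 * ‖ψ t‖ ^ 2) =o[𝓝[>] 0]
        (fun t : ℝ => t) := by
      refine IsLittleO.add ?_ (hψ.const_mul_left 2)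
      exact (((h.norm_left).isBigO.pow 2).trans_isLittleO hid2).const_mul_left 2
    refine IsBigO.trans_isLittleO (IsBigO.of_bound 1 (Eventually.of_forall fun t => ?_)) h1
    have h2 : ‖Complex.log (φ t)‖ ≤ ‖Complex.log (φ t) - ψ t‖ + ‖ψ t‖ := by
      simpa using norm_add_le (Complex.log (φ t) - ψ t) (ψ t)
    rw [one_mul, Real.norm_of_nonneg (by positivity), Real.norm_of_nonneg (by positivity)]
    nlinarith [norm_nonneg (Complex.log (φ t)), sq_nonneg (‖Complex.log (φ t) - ψ t‖ - ‖ψ t‖)]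
  have hexp : (fun t : ℝ => φ t - 1 - Complex.log (φ t)) =o[𝓝[>] 0] (fun t : ℝ => t) := by
    refine IsBigO.trans_isLittleO (IsBigO.of_bound 1 ?_) hsq
    have hn : Tendsto (fun t => ‖Complex.log (φ t)‖) (𝓝[>] 0) (𝓝 0) := by simpa using hl.norm
    filter_upwards [hn.eventually (Iio_mem_nhds (by norm_num : (0:ℝ) < 1)),
      hφ.eventually_ne one_ne_zero] with t ht hne
    have h1 := Complex.norm_exp_sub_one_sub_id_le (x := Complex.log (φ t)) (le_of_lt ht)
    rw [Complex.exp_log hne] at h1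
    rw [one_mul, Real.norm_of_nonneg (by positivity)]
    exact h1
  refine (hexp.add h).congr_left fun t => ?_
  ring

/-! ### The functional equation of stability. -/

lemma exists_continuousOn_log {F : ℝ → ℂ} (hF : Continuous F) (h0 : F 0 = 1) :
    ∃ δ > 0, (∀ t ∈ Set.Icc 0 δ, F t ≠ 0) ∧
      ContinuousOn (fun t => Complex.log (F t)) (Set.Icc 0 δ) := by
  have h1 : ∀ᶠ t in 𝓝 (0 : ℝ), ‖F t - 1‖ < 1 := by
    have : Tendsto (fun t => ‖F t - 1‖) (𝓝 0) (𝓝 0) := by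
      have := ((hF.sub continuous_const).norm : Continuous fun t => ‖F t - 1‖).tendsto 0
      simpa [h0] using this
    exact this.eventually (Iio_mem_nhds one_pos)
  obtain ⟨ε, hε, h2⟩ := Metric.eventually_nhds_iff.1 h1
  have hs : ∀ t ∈ Set.Icc 0 (ε / 2), F t ∈ Complex.slitPlane := by
    intro t ht
    have h3 := h2 (y := t) (by rw [Real.dist_eq, sub_zero, abs_of_nonneg ht.1]; linarith [ht.2])
    simpa using Complex.mem_slitPlane_of_norm_lt_one h3
  exact ⟨ε / 2, by positivity, fun t ht => Complex.slitPlane_ne_zero (hs t ht),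
    fun t ht => (hF.continuousWithinAt).clog (hs t ht)⟩

/-- A continuous solution of the functional equation of `1`-stability is `exp (expo c b)`. -/
lemma eq_exp_expo_of_scaling {F : ℝ → ℂ} (hF : Continuous F) (h0 : F 0 = 1) {b : ℝ}
    (h : ∀ k : ℕ, 1 ≤ k → ∀ t : ℝ,
      F (k * t) = F t ^ k * Complex.exp (-(Complex.I * (k * t) * b * (Real.log k : ℂ)))) :
    ∃ c : ℂ, ∀ t : ℝ, 0 < t → F t = Complex.exp (expo c b t) := by
  obtain ⟨δ, hδ, hne, hψ⟩ := exists_continuousOn_log hF h0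
  set ψ : ℝ → ℂ := fun t => Complex.log (F t) with hψdef
  have hexp : ∀ t ∈ Set.Icc 0 δ, Complex.exp (ψ t) = F t := fun t ht => Complex.exp_log (hne t ht)
  -- Exponentiating gives the relation only modulo `2πi`. The difference of the two sides is
  -- continuous and vanishes at `0`, so the ambiguity disappears.
  have hlin : ∀ k : ℕ, 1 ≤ k → ∀ t ∈ Set.Icc 0 (δ / k),
      ψ (k * t) = k * ψ t - Complex.I * (k * t) * b * (Real.log k : ℂ) := by
    intro k hk t ht
    have hk0 : (0 : ℝ) < k := by exact_mod_cast hk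
    have hk1 : (1 : ℝ) ≤ k := by exact_mod_cast hk
    have hmem : ∀ s ∈ Set.Icc 0 (δ / k), (k * s ∈ Set.Icc 0 δ) ∧ s ∈ Set.Icc 0 δ := by
      intro s hs
      have h2 : k * s ≤ δ := by
        have := hs.2; rw [le_div_iff₀ hk0] at this; linarith
      exact ⟨⟨mul_nonneg hk0.le hs.1, h2⟩, hs.1, by nlinarith [hs.1]⟩
    have hD : ContinuousOn (fun s : ℝ => ψ (k * s) -
        (k * ψ s - Complex.I * (k * s) * b * (Real.log k : ℂ))) (Set.Icc 0 (δ / k)) := by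
      refine ContinuousOn.sub ?_ (ContinuousOn.sub ?_ ?_)
      · exact hψ.comp (by fun_prop) fun s hs => (hmem s hs).1
      · exact continuousOn_const.mul (hψ.mono fun s hs => (hmem s hs).2)
      · exact Continuous.continuousOn (by fun_prop)
    have hone : ∀ s ∈ Set.Icc 0 (δ / k), Complex.exp (ψ (k * s) -
        (k * ψ s - Complex.I * (k * s) * b * (Real.log k : ℂ))) = 1 := by
      intro s hs
      have h3 := h k hk s
      rw [Complex.exp_sub, hexp _ (hmem s hs).1, h3, sub_eq_add_neg, Complex.exp_add,
        Complex.exp_nat_mul, hexp _ (hmem s hs).2]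
      exact div_self (mul_ne_zero (pow_ne_zero _ (hne _ (hmem s hs).2)) (Complex.exp_ne_zero _))
    have := norm_le_of_norm_exp_sub_one_lt hD (by simp [hψdef, h0])
      (fun s hs => by rw [hone s hs]; simp) ht
    rw [hone t ht, sub_self, norm_zero, mul_zero] at this
    exact sub_eq_zero.1 (norm_le_zero_iff.1 this)
  -- `expo 0 b` is a particular solution. Removing it leaves a homogeneous relation, so `g` is
  -- invariant under integer dilations.
  set g : ℝ → ℂ := fun t => (ψ t - expo 0 b t) / t with hg
  have hgk : ∀ k : ℕ, 1 ≤ k → ∀ t : ℝ, 0 < t → k * t ≤ δ → g (k * t) = g t := by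
    intro k hk t ht hkt
    have hk0 : (0 : ℝ) < k := by exact_mod_cast hk
    have h1 := hlin k hk t ⟨ht.le, by rw [le_div_iff₀ hk0]; linarith⟩
    have h2 := expo_mul 0 b hk0 ht
    simp only [hg, h1, h2]
    have : (t : ℂ) ≠ 0 := by exact_mod_cast ht.ne'
    have : (k : ℂ) ≠ 0 := by exact_mod_cast hk0.ne'
    push_cast
    field_simp
    ring
  have hgδ : ∀ k m : ℕ, 1 ≤ m → m ≤ k → g (m * (δ / k)) = g δ := by
    intro k m hm hmk
    have hk0 : (0 : ℝ) < k := by exact_mod_cast (hm.trans hmk)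
    have hmk' : (m : ℝ) ≤ k := by exact_mod_cast hmk
    rw [hgk m hm (δ / k) (by positivity) (by
      rw [← mul_div_assoc, div_le_iff₀ hk0]; nlinarith), ← hgk k (hm.trans hmk) (δ / k)
      (by positivity) (by rw [mul_div_cancel₀ _ hk0.ne'])]
    rw [mul_div_cancel₀ _ hk0.ne']
  have hgc : ContinuousOn g (Set.Ioc 0 δ) := by
    refine ContinuousOn.div ?_ (by fun_prop) fun t ht => by exact_mod_cast ht.1.ne'
    exact (hψ.mono Set.Ioc_subset_Icc_self).sub (continuous_expo 0 b).continuousOn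
  -- Rational multiples of `δ` are handled by `hgδ`; the points `⌊(t/δ)k⌋ δ/k` approach `t` inside
  -- `(0, δ]`, and `g` is continuous there.
  have hconst : ∀ t ∈ Set.Ioc 0 δ, g t = g δ := by
    intro t ht
    have hx : 0 < t / δ := div_pos ht.1 hδ
    have hfl : Tendsto (fun k : ℕ => (⌊(t / δ) * (k : ℝ)⌋₊ : ℝ) / k) atTop (𝓝 (t / δ)) :=
      (tendsto_nat_floor_mul_div_atTop hx.le).comp tendsto_natCast_atTop_atTop
    have hfl2 : Tendsto (fun k : ℕ => (⌊(t / δ) * (k : ℝ)⌋₊ : ℝ) * (δ / k)) atTop (𝓝 t) := by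
      have := hfl.mul_const δ
      rw [div_mul_cancel₀ _ hδ.ne'] at this
      exact this.congr fun k => by ring
    have hev : ∀ᶠ k : ℕ in atTop, 1 ≤ ⌊(t / δ) * (k : ℝ)⌋₊ ∧ ⌊(t / δ) * (k : ℝ)⌋₊ ≤ k := by
      have : ∀ᶠ k : ℕ in atTop, 1 / (t / δ) ≤ (k : ℝ) :=
        tendsto_natCast_atTop_atTop.eventually_ge_atTop _
      filter_upwards [this] with k hk
      constructor
      · rw [Nat.one_le_floor_iff]
        rw [div_le_iff₀ hx] at hk; linarith
      · have : (t / δ) * (k : ℝ) ≤ k := by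
          have : t / δ ≤ 1 := (div_le_one hδ).2 ht.2
          have : (0 : ℝ) ≤ k := k.cast_nonneg
          nlinarith
        exact (Nat.floor_le_floor this).trans (Nat.floor_natCast k).le
    have hw : Tendsto (fun k : ℕ => (⌊(t / δ) * (k : ℝ)⌋₊ : ℝ) * (δ / k)) atTop
        (𝓝[Set.Ioc 0 δ] t) := by
      refine tendsto_nhdsWithin_iff.2 ⟨hfl2, ?_⟩
      filter_upwards [hev] with k hk
      have hk0 : (0 : ℝ) < k := by exact_mod_cast (hk.1.trans hk.2)
      have h1 : (1 : ℝ) ≤ ⌊(t / δ) * (k : ℝ)⌋₊ := by exact_mod_cast hk.1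
      have h2 : (⌊(t / δ) * (k : ℝ)⌋₊ : ℝ) ≤ k := by exact_mod_cast hk.2
      refine ⟨by positivity, ?_⟩
      rw [← mul_div_assoc, div_le_iff₀ hk0]
      nlinarith
    have h1 := (hgc t ht).tendsto.comp hw
    refine tendsto_nhds_unique h1 (tendsto_const_nhds.congr' ?_)
    filter_upwards [hev] with k hk
    exact (hgδ k _ hk.1 hk.2).symm
  refine ⟨g δ, fun t ht => ?_⟩
  have hψe : ∀ s ∈ Set.Ioc 0 δ, ψ s = expo (g δ) b s := by
    intro s hs
    have hs0 : (s : ℂ) ≠ 0 := by exact_mod_cast hs.1.ne'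
    have h1 := hconst s hs
    rw [hg] at h1
    simp only at h1
    rw [div_eq_iff hs0] at h1
    have h2 : ψ s = g δ * s + expo 0 b s := by rw [← h1]; ring
    rw [h2]; simp only [expo]; ring
  -- Beyond `δ` the formula is transported from `t/k ≤ δ` by the scaling relation.
  obtain ⟨k, hk⟩ := exists_nat_ge (max 1 (t / δ))
  have hk1 : (1 : ℝ) ≤ k := (le_max_left _ _).trans hk
  have hk0 : (0 : ℝ) < k := by linarith
  have hs : t / k ∈ Set.Ioc 0 δ := by
    refine ⟨by positivity, ?_⟩
    have := (le_max_right _ _).trans hk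
    rw [div_le_iff₀ hδ] at this
    rw [div_le_iff₀ hk0]; linarith
  have h1 := h k (by exact_mod_cast hk1) (t / k)
  have h2 := expo_mul (g δ) b hk0 hs.1
  rw [mul_div_cancel₀ _ hk0.ne'] at h1 h2
  rw [h1, h2, ← hexp _ (Set.Ioc_subset_Icc_self hs), hψe _ hs, ← Complex.exp_nat_mul,
    ← Complex.exp_add]
  push_cast
  ring_nf

/-! ### Normalised powers versus the expansion of `log φ`. -/

/-- Normalised powers of `φ` converge once `log φ` has the logarithmic expansion at `0`. -/
lemma tendsto_pow_mul_exp {φ : ℝ → ℂ} (hφ : Tendsto φ (𝓝[>] 0) (𝓝 1)) {c : ℂ} {b : ℝ}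
    (h : (fun t : ℝ => Complex.log (φ t) - expo c b t) =o[𝓝[>] 0] (fun t : ℝ => t))
    {t : ℝ} (ht : 0 < t) :
    Tendsto (fun n : ℕ => φ (t / n) ^ n *
      Complex.exp (-(Complex.I * t * b * (Real.log n : ℂ)))) atTop
      (𝓝 (Complex.exp (expo c b t))) := by
  have hlim : Tendsto (fun n : ℕ => t / (n : ℝ)) atTop (𝓝[>] 0) := by
    refine tendsto_nhdsWithin_iff.2 ⟨tendsto_const_div_atTop_nhds_zero_nat t, ?_⟩
    filter_upwards [eventually_gt_atTop 0] with n hn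
    have : (0 : ℝ) < n := by exact_mod_cast hn
    exact div_pos ht this
  have h1 : Tendsto (fun n : ℕ => (n : ℂ) *
      (Complex.log (φ (t / n)) - expo c b (t / n))) atTop (𝓝 0) := by
    have h2 := h.comp_tendsto hlim
    have h3 : (fun n : ℕ => (n : ℂ) * (Complex.log (φ (t / n)) - expo c b (t / n)))
        =o[atTop] (fun n : ℕ => (n : ℝ) * (t / n)) := by
      refine IsBigO.mul_isLittleO (IsBigO.of_bound 1 ?_) h2
      exact Eventually.of_forall fun n => by simp
    have h4 : (fun n : ℕ => (n : ℝ) * (t / n)) =O[atTop] (fun _ : ℕ => (1 : ℝ)) := by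
      refine IsBigO.of_bound |t| ?_
      filter_upwards [eventually_gt_atTop 0] with n hn
      have : (n : ℝ) ≠ 0 := by exact_mod_cast hn.ne'
      rw [mul_div_cancel₀ _ this]; simp
    exact (isLittleO_one_iff ℝ).1 (h3.trans_isBigO h4)
  have h5 := (h1.add_const (expo c b t)).cexp
  rw [zero_add] at h5
  refine h5.congr' ?_
  filter_upwards [eventually_gt_atTop 0, hlim.eventually (hφ.eventually_ne one_ne_zero)]
    with n hn hne
  have hn0 : (0 : ℝ) < n := by exact_mod_cast hn
  have h6 := expo_mul c b hn0 (div_pos ht hn0)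
  rw [mul_div_cancel₀ _ hn0.ne'] at h6
  have hnc : (n : ℂ) ≠ 0 := by exact_mod_cast hn.ne'
  conv_rhs => rw [← Complex.exp_log hne, ← Complex.exp_nat_mul, ← Complex.exp_add]
  rw [h6]
  congr 1
  push_cast
  field_simp
  ring

/-- Conversely, uniform convergence of the normalised powers gives the expansion of `log φ`. -/
lemma log_sub_expo_isLittleO {φ : ℝ → ℂ} (hφ : Continuous φ) (h0 : φ 0 = 1) {c : ℂ} {b : ℝ}
    (h : TendstoUniformlyOn (fun (n : ℕ) (t : ℝ) => φ (t / n) ^ n *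
      Complex.exp (-(Complex.I * t * b * (Real.log n : ℂ))))
      (fun t => Complex.exp (expo c b t)) atTop (Set.Icc 0 1)) :
    (fun t : ℝ => Complex.log (φ t) - expo c b t) =o[𝓝[>] 0] (fun t : ℝ => t) := by
  obtain ⟨δ, hδ, hne, hlog⟩ := exists_continuousOn_log hφ h0
  obtain ⟨K, hK⟩ := (isCompact_Icc (a := (0 : ℝ)) (b := 1)).exists_bound_of_continuousOn
    (continuous_expo c b).continuousOn
  have key : ∀ ε : ℝ, 0 < ε → ε ≤ 1 / 4 → ∀ᶠ n : ℕ in atTop, ∀ t ∈ Set.Icc (0 : ℝ) 1,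
      ‖(n : ℂ) * Complex.log (φ (t / n)) - Complex.I * t * b * (Real.log n : ℂ)
        - expo c b t‖ ≤ 2 * ε := by
    intro ε hε hε4
    -- The factor `exp(-K)` pays for dividing by `exp (expo c b t)`, whose inverse has norm at most
    -- `exp K`.
    have h1 := Metric.tendstoUniformlyOn_iff.1 h (ε * Real.exp (-K)) (by positivity)
    have h2 : ∀ᶠ n : ℕ in atTop, 1 / δ ≤ (n : ℝ) :=
      tendsto_natCast_atTop_atTop.eventually_ge_atTop _
    filter_upwards [h1, h2, eventually_gt_atTop 0] with n hn hnδ hn0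
    have hn0' : (0 : ℝ) < n := by exact_mod_cast hn0
    have hmem : ∀ t ∈ Set.Icc (0 : ℝ) 1, t / n ∈ Set.Icc 0 δ := by
      intro t ht
      refine ⟨div_nonneg ht.1 hn0'.le, ?_⟩
      rw [div_le_iff₀ hδ] at hnδ
      rw [div_le_iff₀ hn0']; linarith [ht.2]
    have hD : ContinuousOn (fun t : ℝ => (n : ℂ) * Complex.log (φ (t / n))
        - Complex.I * t * b * (Real.log n : ℂ) - expo c b t) (Set.Icc 0 1) := by
      refine ContinuousOn.sub (ContinuousOn.sub ?_ (by fun_prop))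
        (continuous_expo c b).continuousOn
      exact continuousOn_const.mul (hlog.comp (by fun_prop) hmem)
    have hlt : ∀ t ∈ Set.Icc (0 : ℝ) 1, ‖Complex.exp ((n : ℂ) * Complex.log (φ (t / n))
        - Complex.I * t * b * (Real.log n : ℂ) - expo c b t) - 1‖ < ε := by
      intro t ht
      have h3 := hn t ht
      rw [dist_comm, Complex.dist_eq] at h3
      have h4 : Complex.exp ((n : ℂ) * Complex.log (φ (t / n))
          - Complex.I * t * b * (Real.log n : ℂ) - expo c b t) - 1 =
          (φ (t / n) ^ n * Complex.exp (-(Complex.I * t * b * (Real.log n : ℂ)))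
            - Complex.exp (expo c b t)) * Complex.exp (-expo c b t) := by
        rw [sub_mul, ← Complex.exp_add (expo c b t), add_neg_cancel, Complex.exp_zero,
          sub_eq_add_neg _ (expo c b t), Complex.exp_add,
          sub_eq_add_neg _ (Complex.I * (t : ℂ) * b * (Real.log n : ℂ)), Complex.exp_add,
          Complex.exp_nat_mul, Complex.exp_log (hne _ (hmem t ht))]
      have h5 : ‖Complex.exp (-expo c b t)‖ ≤ Real.exp K := by
        rw [Complex.norm_exp]
        gcongr
        exact (Complex.re_le_norm _).trans (by rw [norm_neg]; exact hK t ht)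
      rw [h4, norm_mul]
      calc _ ≤ ‖_‖ * Real.exp K := by gcongr
        _ < ε * Real.exp (-K) * Real.exp K := by gcongr
        _ = ε := by rw [mul_assoc, ← Real.exp_add]; simp
    intro t ht
    have h6 := norm_le_of_norm_exp_sub_one_lt hD (by simp [h0])
      (fun s hs => (hlt s hs).trans_le hε4) ht
    linarith [hlt t ht]
  rw [isLittleO_iff]
  intro ε hε
  -- The bound `2 * (ε/4) = ε/2` becomes `ε * (n s)` below because `n s ≥ 1/2`.
  obtain ⟨N, hN⟩ := eventually_atTop.1 (key (min (ε / 4) (1 / 4)) (by positivity) (min_le_right _ _))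
  have hN0 : (0 : ℝ) < 1 / (N + 1) := by positivity
  filter_upwards [Ioo_mem_nhdsGT hN0] with s hs
  have hs0 : 0 < s := hs.1
  have h1s : (N : ℝ) + 1 < 1 / s := by
    rw [lt_div_iff₀ hs0]
    have := hs.2
    rw [lt_div_iff₀ (by positivity)] at this
    linarith
  -- Every small `s` is `t/n` with `t = n s` in `[1/2, 1]`. Since `t` varies with `n`, uniform
  -- convergence is needed.
  set n := ⌊1 / s⌋₊ with hn
  have hn1 : N + 1 ≤ n := Nat.le_floor (by push_cast; exact h1s.le)
  have hn1' : (1 : ℝ) ≤ n := by exact_mod_cast (by omega : 1 ≤ n)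
  have hn0 : (0 : ℝ) < n := by linarith
  have hle : (n : ℝ) ≤ 1 / s := Nat.floor_le (by positivity)
  have hlt : 1 / s < n + 1 := Nat.lt_floor_add_one _
  rw [le_div_iff₀ hs0] at hle
  rw [div_lt_iff₀ hs0] at hlt
  have h2 := hN n (by omega) (n * s) ⟨by positivity, hle⟩
  have h3 := expo_mul c b hn0 hs0
  rw [h3, mul_div_cancel_left₀ _ hn0.ne'] at h2
  have h4 : (n : ℂ) * Complex.log (φ s) - Complex.I * ((n * s : ℝ) : ℂ) * b * (Real.log n : ℂ)
      - ((n : ℝ) * expo c b s - Complex.I * ((n : ℝ) * s) * b * (Real.log n : ℂ))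
      = n * (Complex.log (φ s) - expo c b s) := by push_cast; ring
  rw [h4, norm_mul, Complex.norm_natCast] at h2
  have h5 := min_le_left (ε / 4) (1 / 4)
  rw [Real.norm_of_nonneg hs0.le]
  have h6 : n * ‖Complex.log (φ s) - expo c b s‖ ≤ n * (ε * s) := by
    have h7 : 1 / 2 ≤ n * s := by nlinarith
    have h8 : ε * (1 / 2) ≤ ε * (n * s) := by gcongr
    linarith
  exact le_of_mul_le_mul_left h6 hn0

/-! ### Characteristic functions and weak convergence. -/

section CharFun

/-- A probability measure on `ℝ` whose characteristic function is unimodular is a point mass. -/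
lemma exists_ae_eq_of_norm_charFun_eq_one (ν : Measure ℝ) [IsProbabilityMeasure ν]
    (h : ∀ t : ℝ, ‖charFun ν t‖ = 1) : ∃ c : ℝ, ∀ᵐ x ∂ν, x = c := by
  have hm : AEMeasurable (fun x : ℝ => -1 * x) ν := by fun_prop
  have : IsProbabilityMeasure (ν.map (fun x : ℝ => -1 * x)) :=
    Measure.isProbabilityMeasure_map hm
  have hprob : IsProbabilityMeasure
      ((ν.prod (ν.map (fun x : ℝ => -1 * x))).map (fun p => p.1 + p.2)) :=
    Measure.isProbabilityMeasure_map (by fun_prop)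
  -- Symmetrisation: the difference of two independent copies has characteristic function `|φ|² =
  -- 1`, so it vanishes almost surely. Fubini then freezes one copy.
  have h1 : (ν.prod (ν.map (fun x : ℝ => -1 * x))).map (fun p => p.1 + p.2)
      = Measure.dirac 0 := by
    refine Measure.ext_of_charFun (funext fun t => ?_)
    rw [charFun_map_add_prod_eq_mul, Pi.mul_apply, charFun_map_mul, neg_one_mul, charFun_neg,
      Complex.mul_conj, Complex.normSq_eq_norm_sq, h t]
    simp
  have h2 : ∀ᵐ s ∂((ν.prod (ν.map (fun x : ℝ => -1 * x))).map (fun p => p.1 + p.2)), s = 0 := by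
    rw [h1]; simp [ae_dirac_eq]
  have h3 := ae_of_ae_map (by fun_prop) h2
  obtain ⟨x, hx⟩ := (Measure.ae_ae_of_ae_prod h3).exists
  have h4 := ae_of_ae_map hm hx
  refine ⟨x, ?_⟩
  filter_upwards [h4] with y hy
  linarith

/-- **Lévy's continuity theorem**: a pointwise limit of characteristic functions that is
continuous at `0` is the characteristic function of the weak limit. -/
lemma exists_tendsto_of_tendsto_charFun {μ : ℕ → ProbabilityMeasure ℝ} {f : ℝ → ℂ}
    (hf : ContinuousAt f 0) (h : ∀ t, Tendsto (fun n => charFun (μ n : Measure ℝ) t) atTop (𝓝 (f t))) :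
    ∃ ν : ProbabilityMeasure ℝ, (∀ t, charFun (ν : Measure ℝ) t = f t) ∧
      Tendsto μ atTop (𝓝 ν) := by
  have ht : IsTightMeasureSet (Set.range fun n => (μ n : Measure ℝ)) :=
    isTightMeasureSet_of_tendsto_charFun hf h
  have hcompact : IsCompact (closure (Set.range μ)) := by
    refine isCompact_closure_of_isTightMeasureSet ?_
    convert ht using 1
    ext; simp
  -- Tightness yields a limit along an ultrafilter. Its characteristic function must be `f`, and
  -- this upgrades to convergence of the whole sequence.
  obtain ⟨ν, -, hν⟩ := hcompact.ultrafilter_le_nhds ((Ultrafilter.of atTop).map μ)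
    (.trans (by simp) (monotone_principal subset_closure))
  have hν' : Tendsto μ (Ultrafilter.of (atTop : Filter ℕ)) (𝓝 ν) := hν
  have hchar : ∀ t, charFun (ν : Measure ℝ) t = f t := by
    intro t
    rw [ProbabilityMeasure.tendsto_iff_forall_integral_rclike_tendsto ℂ] at hν'
    have h1 := hν' (BoundedContinuousFunction.innerProbChar t)
    simp_rw [← charFun_eq_integral_innerProbChar] at h1
    exact tendsto_nhds_unique h1 ((h t).mono_left (Ultrafilter.of_le _))
  exact ⟨ν, hchar, ProbabilityMeasure.tendsto_of_tendsto_charFun fun t => by rw [hchar]; exact h t⟩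

/-- On `[-R, R]` the integrand is `R`-Lipschitz in the frequency; elsewhere the difference is at
most `2`. With a tight family, one `R` gives equicontinuity. -/
lemma norm_charFun_sub_le (ν : Measure ℝ) [IsProbabilityMeasure ν] {R : ℝ} (hR : 0 ≤ R)
    (s t : ℝ) :
    ‖charFun ν s - charFun ν t‖ ≤ |s - t| * R + 2 * ν.real (Set.Icc (-R) R)ᶜ := by
  have hi : ∀ u : ℝ, Integrable (fun x : ℝ => Complex.exp (u * x * Complex.I)) ν := by
    intro u
    refine Integrable.of_bound (by fun_prop) 1 (Eventually.of_forall fun x => ?_)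
    have : (u : ℂ) * x * Complex.I = ((u * x : ℝ) : ℂ) * Complex.I := by push_cast; ring
    rw [this, Complex.norm_exp_ofReal_mul_I]
  rw [charFun_apply_real, charFun_apply_real, ← integral_sub (hi s) (hi t)]
  have hb : ∀ x : ℝ, ‖Complex.exp (s * x * Complex.I) - Complex.exp (t * x * Complex.I)‖ ≤
      |s - t| * R * (Set.Icc (-R) R).indicator 1 x + 2 * (Set.Icc (-R) R)ᶜ.indicator 1 x := by
    intro x
    have e1 : ∀ u : ℝ, (u : ℂ) * x * Complex.I = Complex.I * ((u * x : ℝ) : ℂ) := by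
      intro u; push_cast; ring
    rw [e1, e1]
    by_cases hx : x ∈ Set.Icc (-R) R
    · have h1 : Complex.exp (Complex.I * ((s * x : ℝ) : ℂ)) -
          Complex.exp (Complex.I * ((t * x : ℝ) : ℂ)) =
          Complex.exp (Complex.I * ((t * x : ℝ) : ℂ)) *
          (Complex.exp (Complex.I * (((s - t) * x : ℝ) : ℂ)) - 1) := by
        rw [mul_sub, ← Complex.exp_add]; push_cast; ring_nf
      rw [h1, norm_mul, Complex.norm_exp_I_mul_ofReal, one_mul]
      have h2 := Real.norm_exp_I_mul_ofReal_sub_one_le (x := (s - t) * x)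
      have h3 : |x| ≤ R := abs_le.2 hx
      simp only [hx, Set.indicator_of_mem, Set.mem_compl_iff, not_true_eq_false,
        not_false_eq_true, Set.indicator_of_notMem, Pi.one_apply, mul_one, mul_zero, add_zero]
      refine h2.trans ?_
      rw [Real.norm_eq_abs, abs_mul]
      gcongr
    · have h2 := norm_sub_le (Complex.exp (Complex.I * ((s * x : ℝ) : ℂ)))
          (Complex.exp (Complex.I * ((t * x : ℝ) : ℂ)))
      rw [Complex.norm_exp_I_mul_ofReal, Complex.norm_exp_I_mul_ofReal] at h2
      simp [hx]
      push_cast at h2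
      linarith
  have hint : Integrable (fun x : ℝ => |s - t| * R * (Set.Icc (-R) R).indicator (1 : ℝ → ℝ) x) ν :=
    ((integrable_const (1 : ℝ)).indicator measurableSet_Icc).const_mul _
  have hint' : Integrable (fun x : ℝ => 2 * (Set.Icc (-R) R)ᶜ.indicator (1 : ℝ → ℝ) x) ν :=
    ((integrable_const (1 : ℝ)).indicator measurableSet_Icc.compl).const_mul _
  refine (norm_integral_le_of_norm_le (hint.add hint') (Eventually.of_forall hb)).trans ?_
  simp only [Pi.add_apply]
  rw [integral_add hint hint', integral_const_mul, integral_const_mul,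
    integral_indicator_one measurableSet_Icc, integral_indicator_one measurableSet_Icc.compl]
  have : ν.real (Set.Icc (-R) R) ≤ 1 := measureReal_le_one
  have h0 : 0 ≤ |s - t| * R := by positivity
  nlinarith

/-- Weak convergence implies uniform convergence of characteristic functions on compact
intervals. -/
lemma tendstoUniformlyOn_charFun {μ : ℕ → ProbabilityMeasure ℝ} {ν : ProbabilityMeasure ℝ}
    (h : Tendsto μ atTop (𝓝 ν)) (a b : ℝ) :
    TendstoUniformlyOn (fun n t => charFun (μ n : Measure ℝ) t) (charFun (ν : Measure ℝ)) atTop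
      (Set.Icc a b) := by
  have hp := ProbabilityMeasure.tendsto_iff_tendsto_charFun.1 h
  have htight : IsTightMeasureSet (Set.range fun n => (μ n : Measure ℝ)) :=
    isTightMeasureSet_of_tendsto_charFun (f := charFun (ν : Measure ℝ)) (by fun_prop) hp
  have heq : UniformEquicontinuous (fun n t => charFun (μ n : Measure ℝ) t) := by
    rw [Metric.uniformEquicontinuous_iff]
    intro ε hε
    -- The tail contributes at most `2 * ε/6` and the Lipschitz part less than `ε/2`.
    obtain ⟨K, hK, hKm⟩ := isTightMeasureSet_iff_exists_isCompact_measure_compl_le.1 htight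
      (ENNReal.ofReal (ε / 6)) (by simpa using hε)
    obtain ⟨R, hR0, hR⟩ := hK.isBounded.subset_closedBall_lt 0 0
    refine ⟨ε / (2 * R), by positivity, fun x y hxy n => ?_⟩
    have h1 := norm_charFun_sub_le (μ n : Measure ℝ) hR0.le x y
    have h2 : (μ n : Measure ℝ).real (Set.Icc (-R) R)ᶜ ≤ ε / 6 := by
      refine ENNReal.toReal_le_of_le_ofReal (by positivity) ((measure_mono ?_).trans
        (hKm _ ⟨n, rfl⟩))
      rw [Real.closedBall_eq_Icc, zero_sub, zero_add] at hR
      exact Set.compl_subset_compl.2 hR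
    rw [Real.dist_eq, lt_div_iff₀ (by positivity)] at hxy
    rw [dist_eq_norm]
    linarith
  have hu := (EquicontinuousOn.tendsto_uniformOnFun_iff_pi (𝔖 := {K : Set ℝ | IsCompact K})
    (fun K hK => hK) (Set.eq_univ_of_forall fun x => ⟨{x}, isCompact_singleton, rfl⟩)
    (fun K _ => heq.equicontinuous.equicontinuousOn K) atTop (charFun (ν : Measure ℝ))).2
    (tendsto_pi_nhds.2 hp)
  exact UniformOnFun.tendsto_iff_tendstoUniformlyOn.1 hu _ isCompact_Icc

end CharFun

/-! ### The kernel inequality with constant `2/π`. -/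

section Kernel

lemma arctan_le_self {x : ℝ} (hx : 0 ≤ x) : Real.arctan x ≤ x := by
  have := Real.le_tan (Real.arctan_nonneg.2 hx) (Real.arctan_lt_pi_div_two x)
  rwa [Real.tan_arctan] at this

/-- Both functions lie in `[0, r]` for `r ≤ 1`. For `r > 1` their distances to `1` are at most
`1/(1+r²)` and `1/r`. All these are dominated by `2r/(1+r²)`. -/
lemma abs_div_sub_arctan_le {r : ℝ} (hr : 0 < r) :
    |r ^ 2 / (1 + r ^ 2) - 2 / Real.pi * Real.arctan r| ≤ 2 * (r / (1 + r ^ 2)) := by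
  have hpi : 2 / Real.pi < 1 := by
    rw [div_lt_one Real.pi_pos]; linarith [Real.pi_gt_three]
  have hpi0 : 0 < 2 / Real.pi := by positivity
  have hq : 0 < 1 + r ^ 2 := by positivity
  have ha0 : 0 < Real.arctan r := Real.arctan_pos.2 hr
  have hale : Real.arctan r ≤ r := arctan_le_self hr.le
  have hid : r ^ 2 / (1 + r ^ 2) = 1 - 1 / (1 + r ^ 2) := by field_simp; ring
  rcases le_or_gt r 1 with h1 | h1
  · have h2 : r ≤ 2 * (r / (1 + r ^ 2)) := by
      rw [← mul_div_assoc, le_div_iff₀ hq]; nlinarith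
    have h3 : r ^ 2 / (1 + r ^ 2) ≤ r := by rw [div_le_iff₀ hq]; nlinarith
    have h4 : 0 ≤ r ^ 2 / (1 + r ^ 2) := by positivity
    have h5 : 2 / Real.pi * Real.arctan r ≤ r := by nlinarith
    have h6 : 0 ≤ 2 / Real.pi * Real.arctan r := by positivity
    rw [abs_le]; constructor <;> linarith
  · have hinv : Real.arctan r⁻¹ = Real.pi / 2 - Real.arctan r := Real.arctan_inv_of_pos hr
    have hi : Real.arctan r⁻¹ ≤ r⁻¹ := arctan_le_self (by positivity)
    have hi0 : 0 < Real.arctan r⁻¹ := Real.arctan_pos.2 (by positivity)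
    have h2 : 2 / Real.pi * Real.arctan r = 1 - 2 / Real.pi * Real.arctan r⁻¹ := by
      rw [hinv]; field_simp; ring
    have h3 : 2 / Real.pi * Real.arctan r⁻¹ ≤ r⁻¹ := by nlinarith
    have h4 : r⁻¹ ≤ 2 * (r / (1 + r ^ 2)) := by
      rw [inv_eq_one_div, ← mul_div_assoc, div_le_div_iff₀ hr hq]; nlinarith
    have h5 : 1 / (1 + r ^ 2) ≤ 2 * (r / (1 + r ^ 2)) := by
      rw [← mul_div_assoc]; gcongr; linarith
    have h6 : 0 < 2 / Real.pi * Real.arctan r⁻¹ := by positivity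
    have h7 : 0 < 1 / (1 + r ^ 2) := by positivity
    rw [h2, hid, abs_le]; constructor <;> linarith

lemma integral_sq_div_sq_add_sq {x U V : ℝ} (hx : x ≠ 0) :
    ∫ s in U..V, x ^ 2 / (x ^ 2 + s ^ 2) = |x| * (Real.arctan (V / |x|) - Real.arctan (U / |x|)) := by
  have hx0 : 0 < |x| := abs_pos.2 hx
  have hne : ∀ s : ℝ, x ^ 2 + s ^ 2 ≠ 0 := fun s => by positivity
  have hd : ∀ s ∈ Set.uIcc U V, HasDerivAt (fun s => |x| * Real.arctan (s / |x|))
      (x ^ 2 / (x ^ 2 + s ^ 2)) s := by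
    intro s _
    have h1 : HasDerivAt (fun s => |x| * Real.arctan (s / |x|)) _ s :=
      (((hasDerivAt_id s).div_const |x|).arctan).const_mul |x|
    refine h1.congr_deriv ?_
    simp only [id]
    rw [div_pow, sq_abs]
    have := hne s
    field_simp
  rw [intervalIntegral.integral_eq_sub_of_hasDerivAt hd]
  · ring
  · exact (Continuous.div (by fun_prop) (by fun_prop) hne).intervalIntegrable _ _

/-- With `r = s/|x|`, the kernel is `|x| r²/(1+r²)` up to sign. Replacing it by `(2/π)|x| arctan r`
costs one boundary term at each end, and the increment of the replacement is exactly the integral.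
-/
lemma abs_kernel_sub_le {x U V : ℝ} (hU : 0 < U) (hUV : U ≤ V) :
    |V ^ 2 * x / (V ^ 2 + x ^ 2) - U ^ 2 * x / (U ^ 2 + x ^ 2)| ≤
      2 / Real.pi * (∫ s in U..V, x ^ 2 / (x ^ 2 + s ^ 2)) +
        2 * (V * (x ^ 2 / (x ^ 2 + V ^ 2))) + 2 * (U * (x ^ 2 / (x ^ 2 + U ^ 2))) := by
  have hV : 0 < V := hU.trans_le hUV
  rcases eq_or_ne x 0 with rfl | hx
  · simp
  have hx0 : 0 < |x| := abs_pos.2 hx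
  have hP : ∀ s : ℝ, 0 < s → s ^ 2 * |x| / (s ^ 2 + x ^ 2) =
      |x| * ((s / |x|) ^ 2 / (1 + (s / |x|) ^ 2)) := by
    intro s hs
    rw [← sq_abs x]
    field_simp
    ring
  have hQ : ∀ s : ℝ, 0 < s → s * (x ^ 2 / (x ^ 2 + s ^ 2)) =
      |x| * ((s / |x|) / (1 + (s / |x|) ^ 2)) := by
    intro s hs
    rw [← sq_abs x]
    field_simp
  have habs : |V ^ 2 * x / (V ^ 2 + x ^ 2) - U ^ 2 * x / (U ^ 2 + x ^ 2)| =
      |V ^ 2 * |x| / (V ^ 2 + x ^ 2) - U ^ 2 * |x| / (U ^ 2 + x ^ 2)| := by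
    rcases abs_choice x with h | h
    · rw [h]
    · rw [h, mul_neg, mul_neg, neg_div, neg_div, neg_sub_neg, abs_sub_comm]
  have hnn : 0 ≤ 2 / Real.pi * (|x| * (Real.arctan (V / |x|) - Real.arctan (U / |x|))) := by
    have : Real.arctan (U / |x|) ≤ Real.arctan (V / |x|) :=
      Real.arctan_mono (by gcongr)
    have := Real.pi_pos
    have h3 := sub_nonneg.2 ‹Real.arctan (U / |x|) ≤ Real.arctan (V / |x|)›
    positivity
  have hv := abs_le.1 (abs_div_sub_arctan_le (div_pos hV hx0))
  have hu := abs_le.1 (abs_div_sub_arctan_le (div_pos hU hx0))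
  rw [habs, hP V hV, hP U hU, hQ V hV, hQ U hU, integral_sq_div_sq_add_sq hx, abs_le]
  have m1 := mul_le_mul_of_nonneg_left hv.1 hx0.le
  have m2 := mul_le_mul_of_nonneg_left hv.2 hx0.le
  have m3 := mul_le_mul_of_nonneg_left hu.1 hx0.le
  have m4 := mul_le_mul_of_nonneg_left hu.2 hx0.le
  constructor <;> linarith

end Kernel

/-! ### Laplace transforms of characteristic functions. -/

section Resolvent

variable (μ : Measure ℝ) [IsProbabilityMeasure μ]

/-- Fubini. The behaviour of `φ` near `0` thereby becomes the behaviour of rational kernels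
integrated against `μ` for large `u`. -/
lemma integral_exp_mul_charFun {u : ℝ} (hu : 0 < u) :
    ∫ t in Set.Ioi (0 : ℝ), (Real.exp (-u * t) : ℂ) * charFun μ t =
      ∫ x : ℝ, (1 : ℂ) / (u - x * Complex.I) ∂μ := by
  have hint : Integrable (Function.uncurry fun (t x : ℝ) =>
      (Real.exp (-u * t) : ℂ) * Complex.exp (t * x * Complex.I))
      ((volume.restrict (Set.Ioi 0)).prod μ) := by
    have h1 : Integrable (fun t : ℝ => Real.exp (-u * t)) (volume.restrict (Set.Ioi 0)) :=
      integrableOn_exp_mul_Ioi (by linarith) 0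
    have h2 : Integrable (fun p : ℝ × ℝ => Real.exp (-u * p.1))
        ((volume.restrict (Set.Ioi 0)).prod μ) := h1.comp_fst μ
    refine h2.mono' (by fun_prop) (Eventually.of_forall fun p => ?_)
    have e1 : (p.1 : ℂ) * p.2 * Complex.I = ((p.1 * p.2 : ℝ) : ℂ) * Complex.I := by push_cast; ring
    simp only [Function.uncurry, e1, norm_mul, Complex.norm_exp_ofReal_mul_I, mul_one,
      Complex.norm_real, Real.norm_eq_abs, Real.abs_exp, le_refl]
  calc ∫ t in Set.Ioi (0 : ℝ), (Real.exp (-u * t) : ℂ) * charFun μ t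
      = ∫ t in Set.Ioi (0 : ℝ), (∫ x : ℝ,
          (Real.exp (-u * t) : ℂ) * Complex.exp (t * x * Complex.I) ∂μ) := by
        simp_rw [integral_const_mul, charFun_apply_real]
    _ = ∫ x : ℝ, (∫ t in Set.Ioi (0 : ℝ),
          (Real.exp (-u * t) : ℂ) * Complex.exp (t * x * Complex.I)) ∂μ :=
        integral_integral_swap hint
    _ = _ := by
        congr 1; funext x
        have h3 := integral_exp_mul_complex_Ioi (a := -u + x * Complex.I) (by simpa using hu) 0
        have h4 : ∀ t : ℝ, (Real.exp (-u * t) : ℂ) * Complex.exp (t * x * Complex.I) =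
            Complex.exp ((-u + x * Complex.I) * t) := by
          intro t
          rw [Complex.ofReal_exp, ← Complex.exp_add]; push_cast; ring_nf
        simp_rw [h4]
        rw [h3]
        simp only [Complex.ofReal_zero, mul_zero, Complex.exp_zero]
        rw [← neg_div_neg_eq, neg_neg]
        congr 1; ring

lemma one_div_sub_mul_I {u x : ℝ} (hu : 0 < u) :
    (1 : ℂ) / (u - x * Complex.I) =
      ((u / (u ^ 2 + x ^ 2) : ℝ) : ℂ) + ((x / (u ^ 2 + x ^ 2) : ℝ) : ℂ) * Complex.I := by
  have h1 : (u : ℂ) ^ 2 + (x : ℂ) ^ 2 ≠ 0 := by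
    have : u ^ 2 + x ^ 2 ≠ 0 := by positivity
    exact_mod_cast this
  have h2 : (u : ℂ) - x * Complex.I ≠ 0 := by
    intro h; have := congrArg Complex.re h; simp at this; exact hu.ne' this
  push_cast
  rw [div_eq_iff h2]
  field_simp
  ring_nf
  rw [Complex.I_sq]; ring

lemma integrable_exp_mul_charFun {u : ℝ} (hu : 0 < u) :
    IntegrableOn (fun t : ℝ => (Real.exp (-u * t) : ℂ) * charFun μ t) (Set.Ioi 0) := by
  have h1 : Integrable (fun t : ℝ => Real.exp (-u * t)) (volume.restrict (Set.Ioi 0)) :=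
    integrableOn_exp_mul_Ioi (by linarith) 0
  refine h1.mono' ?_ (Eventually.of_forall fun t => ?_)
  · exact (Continuous.aestronglyMeasurable (by fun_prop)).mul
      stronglyMeasurable_charFun.aestronglyMeasurable
  · rw [norm_mul, Complex.norm_real, Real.norm_eq_abs, Real.abs_exp]
    exact mul_le_of_le_one_right (Real.exp_nonneg _) (norm_charFun_le_one t)

lemma integrable_bounded {f : ℝ → ℝ} (hf : Measurable f) (C : ℝ) (h : ∀ x, |f x| ≤ C) :
    Integrable f μ :=
  Integrable.of_bound hf.aestronglyMeasurable C (Eventually.of_forall h)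

lemma integrable_one_div_sub {u : ℝ} (hu : 0 < u) :
    Integrable (fun x : ℝ => (1 : ℂ) / (u - x * Complex.I)) μ := by
  refine Integrable.of_bound (Measurable.aestronglyMeasurable (by fun_prop)) (1 / u) (Eventually.of_forall fun x => ?_)
  rw [norm_div, norm_one]
  gcongr
  have := Complex.abs_re_le_norm ((u : ℂ) - x * Complex.I)
  simpa [abs_of_pos hu] using this

/-- The real part of the Laplace transform of a characteristic function. -/
lemma integral_exp_mul_re_charFun {u : ℝ} (hu : 0 < u) :
    ∫ t in Set.Ioi (0 : ℝ), Real.exp (-u * t) * (charFun μ t).re = ∫ x, u / (u ^ 2 + x ^ 2) ∂μ := by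
  have h := congrArg Complex.re (integral_exp_mul_charFun μ hu)
  have h1 := integral_re (𝕜 := ℂ) (integrable_exp_mul_charFun μ hu)
  have h2 := integral_re (𝕜 := ℂ) (integrable_one_div_sub μ hu)
  simp only [RCLike.re_eq_complex_re] at h1 h2
  rw [← h1, ← h2] at h
  simp_rw [one_div_sub_mul_I hu, Complex.re_ofReal_mul, Complex.add_re,
    Complex.ofReal_re, Complex.re_ofReal_mul, Complex.I_re, mul_zero, add_zero] at h
  exact h

/-- The imaginary part of the Laplace transform of a characteristic function. -/
lemma integral_exp_mul_im_charFun {u : ℝ} (hu : 0 < u) :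
    ∫ t in Set.Ioi (0 : ℝ), Real.exp (-u * t) * (charFun μ t).im = ∫ x, x / (u ^ 2 + x ^ 2) ∂μ := by
  have h := congrArg Complex.im (integral_exp_mul_charFun μ hu)
  have h1 := integral_im (𝕜 := ℂ) (integrable_exp_mul_charFun μ hu)
  have h2 := integral_im (𝕜 := ℂ) (integrable_one_div_sub μ hu)
  simp only [RCLike.im_eq_complex_im] at h1 h2
  rw [← h1, ← h2] at h
  simp_rw [one_div_sub_mul_I hu, Complex.im_ofReal_mul, Complex.add_im,
    Complex.ofReal_im, Complex.im_ofReal_mul, Complex.I_im, mul_one, zero_add] at h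
  exact h

end Resolvent

/-! ### Model integrals and global bounds. -/

lemma integral_exp_mul_id {u : ℝ} (hu : 0 < u) :
    ∫ t in Set.Ioi (0 : ℝ), Real.exp (-u * t) * t = 1 / u ^ 2 := by
  have h := Real.integral_rpow_mul_exp_neg_mul_Ioi (a := 2) (by norm_num) hu
  rw [Real.Gamma_two] at h
  norm_num at h
  rw [one_div, ← h]
  congr 1; funext t; rw [mul_comm, neg_mul]

lemma integral_exp_mul_sq {u : ℝ} (hu : 0 < u) :
    ∫ t in Set.Ioi (0 : ℝ), Real.exp (-u * t) * t ^ 2 = 2 / u ^ 3 := by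
  have h := Real.integral_rpow_mul_exp_neg_mul_Ioi (a := 3) (by norm_num) hu
  have hG : Real.Gamma 3 = 2 := by
    rw [show (3 : ℝ) = (2 : ℕ) + 1 by norm_num, Real.Gamma_nat_eq_factorial]
    norm_num
  rw [hG] at h
  norm_num at h
  rw [div_eq_inv_mul, ← h]
  congr 1; funext t; rw [mul_comm, neg_mul]

lemma integrable_exp_mul_id {u : ℝ} (hu : 0 < u) :
    IntegrableOn (fun t : ℝ => Real.exp (-u * t) * t) (Set.Ioi 0) :=
  -- A non-integrable function has integral `0` by default, so a non-zero value proves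
  -- integrability.
  Integrable.of_integral_ne_zero (by rw [integral_exp_mul_id hu]; positivity)

lemma integrable_exp_mul_sq {u : ℝ} (hu : 0 < u) :
    IntegrableOn (fun t : ℝ => Real.exp (-u * t) * t ^ 2) (Set.Ioi 0) :=
  Integrable.of_integral_ne_zero (by rw [integral_exp_mul_sq hu]; positivity)

lemma integrable_exp {u : ℝ} (hu : 0 < u) :
    IntegrableOn (fun t : ℝ => Real.exp (-u * t)) (Set.Ioi 0) :=
  integrableOn_exp_mul_Ioi (by linarith) 0

lemma integral_exp {u : ℝ} (hu : 0 < u) :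
    ∫ t in Set.Ioi (0 : ℝ), Real.exp (-u * t) = 1 / u := by
  rw [integral_exp_mul_Ioi (by linarith)]; simp

lemma abs_mul_log_le {t : ℝ} (ht : 0 < t) : |t * Real.log t| ≤ 1 + t ^ 2 := by
  have h1 := Real.log_le_sub_one_of_pos ht
  have h2 := Real.log_le_sub_one_of_pos (inv_pos.2 ht)
  rw [Real.log_inv] at h2
  have h3 : t * t⁻¹ = 1 := mul_inv_cancel₀ ht.ne'
  rw [abs_le]; constructor <;> nlinarith

lemma integrable_exp_mul_log {u : ℝ} (hu : 0 < u) :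
    IntegrableOn (fun t : ℝ => Real.exp (-u * t) * (t * Real.log t)) (Set.Ioi 0) := by
  refine Integrable.mono' ((integrable_exp hu).add (integrable_exp_mul_sq hu))
    (Measurable.aestronglyMeasurable (by fun_prop)) ?_
  filter_upwards [ae_restrict_mem measurableSet_Ioi] with t ht
  rw [norm_mul, Real.norm_eq_abs, Real.abs_exp, Real.norm_eq_abs, Pi.add_apply]
  have := mul_le_mul_of_nonneg_left (abs_mul_log_le ht) (Real.exp_nonneg (-u * t))
  linarith

/-- The substitution `t ↦ u t` splits off `log u`. The remaining integral only matters as a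
constant. -/
lemma integral_exp_mul_log {u : ℝ} (hu : 0 < u) :
    u ^ 2 * ∫ t in Set.Ioi (0 : ℝ), Real.exp (-u * t) * (t * Real.log t) =
      (∫ t in Set.Ioi (0 : ℝ), Real.exp (-1 * t) * (t * Real.log t)) - Real.log u := by
  have h := integral_comp_mul_left_Ioi (fun t : ℝ => Real.exp (-1 * t) * (t * Real.log t)) 0 hu
  rw [mul_zero, smul_eq_mul] at h
  have h1 : ∫ t in Set.Ioi (0 : ℝ), Real.exp (-1 * (u * t)) * (u * t * Real.log (u * t)) =
      u * Real.log u * (∫ t in Set.Ioi (0 : ℝ), Real.exp (-u * t) * t) +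
      u * ∫ t in Set.Ioi (0 : ℝ), Real.exp (-u * t) * (t * Real.log t) := by
    rw [← integral_const_mul, ← integral_const_mul, ← integral_add
      ((integrable_exp_mul_id hu).const_mul _) ((integrable_exp_mul_log hu).const_mul _)]
    refine setIntegral_congr_fun measurableSet_Ioi fun t ht => ?_
    simp only [Real.log_mul hu.ne' (ne_of_gt ht)]
    rw [show -1 * (u * t) = -u * t by ring]
    ring
  rw [h1, integral_exp_mul_id hu] at h
  generalize (∫ t in Set.Ioi (0 : ℝ), Real.exp (-1 * t) * (t * Real.log t)) = G at h ⊢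
  generalize (∫ t in Set.Ioi (0 : ℝ), Real.exp (-u * t) * (t * Real.log t)) = J at h ⊢
  field_simp at h
  linarith

/-- Global bounds on a bounded function implied by its logarithmic expansion at `0`. -/
lemma exists_global_bound {φ : ℝ → ℂ} (hφ : ∀ t, ‖φ t‖ ≤ 1) {b κ l : ℝ}
    (h : HasLogExpansion φ b κ l) {ε : ℝ} (hε : 0 < ε) :
    ∃ C : ℝ, 0 ≤ C ∧ (∀ t, 0 < t → 1 - (φ t).re ≤ (κ + ε) * t + C * t ^ 2) ∧
      ∀ t, 0 < t → |(φ t).im + b * (t * Real.log t)| ≤ C * t + C * t ^ 2 := by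
  rw [HasLogExpansion, isLittleO_iff] at h
  obtain ⟨δ, hδ, hb⟩ := mem_nhdsGT_iff_exists_Ioc_subset.1 (h hε)
  have hδ0 : (0 : ℝ) < δ := hδ
  have hre : ∀ t, (φ t - (1 - ((κ : ℂ) - Complex.I * l) * t
      - Complex.I * b * t * (Real.log t : ℂ))).re = (φ t).re - 1 + κ * t := by
    intro t; simp; ring
  have him : ∀ t, (φ t - (1 - ((κ : ℂ) - Complex.I * l) * t
      - Complex.I * b * t * (Real.log t : ℂ))).im = (φ t).im + b * (t * Real.log t) - l * t := by
    intro t; simp; ring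
  -- Beyond `δ`, `1` and `t` are at most `t²/δ²` and `t²/δ`, so trivial bounds fit into `C t²`. Only
  -- the coefficient `κ + ε` has to stay sharp.
  set C := (2 + |b|) / δ ^ 2 + |b| + |l| + ε + |κ + ε| / δ with hC
  have hC0 : 0 ≤ C := by positivity
  have hfar : ∀ t, δ < t → 1 ≤ t ^ 2 / δ ^ 2 ∧ t ≤ t ^ 2 / δ := by
    intro t ht
    constructor
    · rw [le_div_iff₀ (by positivity)]; nlinarith
    · rw [le_div_iff₀ (by positivity)]; nlinarith
  refine ⟨C, hC0, fun t ht => ?_, fun t ht => ?_⟩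
  · rcases le_or_gt t δ with h1 | h1
    · have h2 := (Complex.abs_re_le_norm _).trans (hb ⟨ht, h1⟩)
      rw [hre, Real.norm_of_nonneg ht.le] at h2
      have := (abs_le.1 h2).1
      have : 0 ≤ C * t ^ 2 := by positivity
      linarith
    · obtain ⟨h2, h3⟩ := hfar t h1
      have h4 := (abs_le.1 ((Complex.abs_re_le_norm _).trans (hφ t))).1
      have h5 : C * t ^ 2 = (2 + |b|) * (t ^ 2 / δ ^ 2) + (|b| + |l| + ε) * t ^ 2
          + |κ + ε| * (t ^ 2 / δ) := by rw [hC]; ring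
      have h6 : 2 ≤ (2 + |b|) * (t ^ 2 / δ ^ 2) := by nlinarith [abs_nonneg b]
      have h7 : |κ + ε| * t ≤ |κ + ε| * (t ^ 2 / δ) := by gcongr
      have h8 : -(|κ + ε| * t) ≤ (κ + ε) * t := by nlinarith [neg_abs_le (κ + ε)]
      have h9 : 0 ≤ (|b| + |l| + ε) * t ^ 2 := by positivity
      rw [h5]; linarith
  · rcases le_or_gt t δ with h1 | h1
    · have h2 := (Complex.abs_im_le_norm _).trans (hb ⟨ht, h1⟩)
      rw [him, Real.norm_of_nonneg ht.le] at h2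
      have h3 : |(φ t).im + b * (t * Real.log t)| ≤ ε * t + |l| * t := by
        have := abs_add_le ((φ t).im + b * (t * Real.log t) - l * t) (l * t)
        rw [sub_add_cancel, abs_mul l, abs_of_pos ht] at this
        linarith
      have h4 : ε + |l| ≤ C := by
        have : 0 ≤ (2 + |b|) / δ ^ 2 + |b| + |κ + ε| / δ := by positivity
        rw [hC]; linarith
      have : 0 ≤ C * t ^ 2 := by positivity
      nlinarith
    · obtain ⟨h2, h3⟩ := hfar t h1
      have h4 := (Complex.abs_im_le_norm _).trans (hφ t)
      have h5 : |b * (t * Real.log t)| ≤ |b| * (1 + t ^ 2) := by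
        rw [abs_mul]; gcongr; exact abs_mul_log_le ht
      have h6 := abs_add_le (φ t).im (b * (t * Real.log t))
      have h7 : C * t ^ 2 = (2 + |b|) * (t ^ 2 / δ ^ 2) + |b| * t ^ 2 + (|l| + ε) * t ^ 2
          + |κ + ε| * (t ^ 2 / δ) := by rw [hC]; ring
      have h8 : 1 + |b| ≤ (2 + |b|) * (t ^ 2 / δ ^ 2) := by nlinarith [abs_nonneg b]
      have h9 : 0 ≤ (|l| + ε) * t ^ 2 := by positivity
      have h10 : 0 ≤ |κ + ε| * (t ^ 2 / δ) := by positivity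
      have h11 : 0 ≤ C * t := by positivity
      rw [h7]; linarith

/-! ### The bound on `|b|`. -/

variable (μ : Measure ℝ) [IsProbabilityMeasure μ]

lemma measurable_re_charFun : Measurable fun t => (charFun μ t).re :=
  Complex.measurable_re.comp measurable_charFun

lemma measurable_im_charFun : Measurable fun t => (charFun μ t).im :=
  Complex.measurable_im.comp measurable_charFun

lemma integrable_sq_div (u : ℝ) : Integrable (fun x : ℝ => x ^ 2 / (x ^ 2 + u ^ 2)) μ :=
  integrable_bounded μ (by fun_prop) 1 fun x => by
    rw [abs_of_nonneg (by positivity)]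
    exact div_le_one_of_le₀ (by nlinarith [sq_nonneg u]) (by positivity)

/-- The left side equals `u ∫ e^(-ut) (1 - Re φ(t)) dt`, into which the hypothesis is inserted. -/
lemma integral_sq_div_le {A C : ℝ}
    (h : ∀ t, 0 < t → 1 - (charFun μ t).re ≤ A * t + C * t ^ 2) {u : ℝ} (hu : 0 < u) :
    ∫ x, x ^ 2 / (x ^ 2 + u ^ 2) ∂μ ≤ A / u + 2 * C / u ^ 2 := by
  have hre := integral_exp_mul_re_charFun μ hu
  have hire : IntegrableOn (fun t : ℝ => Real.exp (-u * t) * (charFun μ t).re) (Set.Ioi 0) := by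
    refine (integrable_exp hu).mono' ((Measurable.aestronglyMeasurable (by fun_prop)).mul
      (measurable_re_charFun μ).aestronglyMeasurable) (Eventually.of_forall fun t => ?_)
    rw [norm_mul, Real.norm_eq_abs, Real.abs_exp]
    exact mul_le_of_le_one_right (Real.exp_nonneg _)
      ((Complex.abs_re_le_norm _).trans (norm_charFun_le_one t))
  have h1 : ∫ x, x ^ 2 / (x ^ 2 + u ^ 2) ∂μ = 1 - u * ∫ x, u / (u ^ 2 + x ^ 2) ∂μ := by
    have h2 : ∀ x : ℝ, x ^ 2 / (x ^ 2 + u ^ 2) = 1 - u * (u / (u ^ 2 + x ^ 2)) := by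
      intro x; field_simp; ring
    simp_rw [h2]
    rw [integral_sub (integrable_const _), integral_const_mul]
    · simp
    · refine integrable_bounded μ (by fun_prop) 1 fun x => ?_
      rw [abs_of_nonneg (by positivity), ← mul_div_assoc]
      exact div_le_one_of_le₀ (by nlinarith [sq_nonneg x]) (by positivity)
  have h3 : ∫ t in Set.Ioi (0 : ℝ), Real.exp (-u * t) * (1 - (charFun μ t).re) ≤
      A * (1 / u ^ 2) + C * (2 / u ^ 3) := by
    rw [← integral_exp_mul_id hu, ← integral_exp_mul_sq hu, ← integral_const_mul,
      ← integral_const_mul, ← integral_add ((integrable_exp_mul_id hu).const_mul _)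
      ((integrable_exp_mul_sq hu).const_mul _)]
    refine setIntegral_mono_on ?_ (((integrable_exp_mul_id hu).const_mul _).add
      ((integrable_exp_mul_sq hu).const_mul _)) measurableSet_Ioi fun t ht => ?_
    · simp_rw [mul_sub, mul_one]
      exact (integrable_exp hu).sub hire
    · have := mul_le_mul_of_nonneg_left (h t ht) (Real.exp_nonneg (-u * t))
      linarith
  have h4 : ∫ t in Set.Ioi (0 : ℝ), Real.exp (-u * t) * (1 - (charFun μ t).re) =
      1 / u - ∫ x, u / (u ^ 2 + x ^ 2) ∂μ := by
    simp_rw [mul_sub, mul_one]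
    rw [integral_sub (integrable_exp hu) hire, integral_exp hu, hre]
  rw [h4] at h3
  rw [h1]
  have h5 := mul_le_mul_of_nonneg_left h3 hu.le
  have h6 : u * (A * (1 / u ^ 2) + C * (2 / u ^ 3)) = A / u + 2 * C / u ^ 2 := by field_simp
  have h7 : u * (1 / u) = 1 := by field_simp
  rw [h6, mul_sub, h7] at h5
  exact h5

/-- The integral is `u² ∫ e^(-ut) Im φ(t) dt`; the part `-b t log t` of `Im φ` produces `b log u`,
and the rest stays bounded for `u ≥ 1`. -/
lemma exists_abs_integral_sub_log_le {b C : ℝ} (hC : 0 ≤ C)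
    (h : ∀ t, 0 < t → |(charFun μ t).im + b * (t * Real.log t)| ≤ C * t + C * t ^ 2) :
    ∃ M : ℝ, ∀ u : ℝ, 1 ≤ u → |(∫ x, u ^ 2 * x / (u ^ 2 + x ^ 2) ∂μ) - b * Real.log u| ≤ M := by
  set G := ∫ t in Set.Ioi (0 : ℝ), Real.exp (-1 * t) * (t * Real.log t) with hG
  refine ⟨3 * C + |b * G|, fun u hu1 => ?_⟩
  have hu : 0 < u := by linarith
  have him := integral_exp_mul_im_charFun μ hu
  have hiim : IntegrableOn (fun t : ℝ => Real.exp (-u * t) * (charFun μ t).im) (Set.Ioi 0) := by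
    refine (integrable_exp hu).mono' ((Measurable.aestronglyMeasurable (by fun_prop)).mul
      (measurable_im_charFun μ).aestronglyMeasurable) (Eventually.of_forall fun t => ?_)
    rw [norm_mul, Real.norm_eq_abs, Real.abs_exp]
    exact mul_le_of_le_one_right (Real.exp_nonneg _)
      ((Complex.abs_im_le_norm _).trans (norm_charFun_le_one t))
  have h1 : ∫ x, u ^ 2 * x / (u ^ 2 + x ^ 2) ∂μ = u ^ 2 * ∫ x, x / (u ^ 2 + x ^ 2) ∂μ := by
    rw [← integral_const_mul]; simp_rw [mul_div_assoc]
  have h2 : |∫ t in Set.Ioi (0 : ℝ), Real.exp (-u * t) *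
      ((charFun μ t).im + b * (t * Real.log t))| ≤ C * (1 / u ^ 2) + C * (2 / u ^ 3) := by
    rw [← integral_exp_mul_id hu, ← integral_exp_mul_sq hu, ← integral_const_mul,
      ← integral_const_mul, ← integral_add ((integrable_exp_mul_id hu).const_mul _)
      ((integrable_exp_mul_sq hu).const_mul _), ← Real.norm_eq_abs]
    refine norm_integral_le_of_norm_le (((integrable_exp_mul_id hu).const_mul _).add
      ((integrable_exp_mul_sq hu).const_mul _)) ?_
    filter_upwards [ae_restrict_mem measurableSet_Ioi] with t ht
    rw [norm_mul, Real.norm_eq_abs, Real.abs_exp, Real.norm_eq_abs]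
    have := mul_le_mul_of_nonneg_left (h t ht) (Real.exp_nonneg (-u * t))
    linarith
  have h3 : ∫ t in Set.Ioi (0 : ℝ), Real.exp (-u * t) *
      ((charFun μ t).im + b * (t * Real.log t)) = (∫ x, x / (u ^ 2 + x ^ 2) ∂μ) +
      b * ∫ t in Set.Ioi (0 : ℝ), Real.exp (-u * t) * (t * Real.log t) := by
    rw [← him, ← integral_const_mul, ← integral_add hiim ((integrable_exp_mul_log hu).const_mul _)]
    congr 1; funext t; ring
  have h4 := integral_exp_mul_log hu
  rw [h3] at h2
  have h5 := mul_le_mul_of_nonneg_left h2 (by positivity : 0 ≤ u ^ 2)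
  rw [← abs_of_nonneg (by positivity : 0 ≤ u ^ 2), ← abs_mul, abs_of_nonneg (by positivity : 0 ≤ u ^ 2),
    mul_add, mul_left_comm _ b, h4, ← h1] at h5
  have h6 : u ^ 2 * (C * (1 / u ^ 2) + C * (2 / u ^ 3)) = C + C * (2 / u) := by
    field_simp
  have h7 : 2 / u ≤ 2 := div_le_self (by norm_num) hu1
  rw [h6] at h5
  have h8 := abs_sub ((∫ x, u ^ 2 * x / (u ^ 2 + x ^ 2) ∂μ) + b * (G - Real.log u)) (b * G)
  have h9 : (∫ x, u ^ 2 * x / (u ^ 2 + x ^ 2) ∂μ) + b * (G - Real.log u) - b * G =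
      (∫ x, u ^ 2 * x / (u ^ 2 + x ^ 2) ∂μ) - b * Real.log u := by ring
  rw [h9] at h8
  nlinarith

/-- The bound `|b| ≤ 2 κ / π` on the coefficient of the logarithmic term. -/
lemma abs_le_of_hasLogExpansion {b κ l : ℝ} (h : HasLogExpansion (charFun μ) b κ l) :
    |b| ≤ 2 * κ / Real.pi := by
  have hpi := Real.pi_pos
  suffices H : ∀ ε : ℝ, 0 < ε → |b| ≤ 2 / Real.pi * (κ + ε) by
    have h1 : |b| ≤ 2 / Real.pi * κ := by
      refine le_of_forall_pos_le_add fun η hη => ?_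
      have := H (η * Real.pi / 2) (by positivity)
      rwa [mul_add, show 2 / Real.pi * (η * Real.pi / 2) = η by field_simp] at this
    rw [mul_div_right_comm]; exact h1
  intro ε hε
  obtain ⟨C, hC, hre, him⟩ := exists_global_bound (fun t => norm_charFun_le_one t) h hε
  obtain ⟨M, hM⟩ := exists_abs_integral_sub_log_le μ hC him
  set A := κ + ε
  have ha := fun u hu => integral_sq_div_le μ hre (u := u) hu
  set K := 2 * M + 2 / Real.pi * (2 * C) + 4 * (|A| + 2 * C) with hK
  -- The kernel inequality is integrated against `μ` with `U = 1`; `K` does not depend on `V`.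
  have key : ∀ V : ℝ, 1 ≤ V → |b| * Real.log V ≤ 2 / Real.pi * A * Real.log V + K := by
    intro V hV
    have hV0 : 0 < V := by linarith
    have hk : ∀ u : ℝ, 0 < u → Integrable (fun x : ℝ => u ^ 2 * x / (u ^ 2 + x ^ 2)) μ := by
      intro u hu
      refine integrable_bounded μ (by fun_prop) u fun x => ?_
      rw [abs_div, abs_mul, abs_of_nonneg (by positivity : 0 ≤ u ^ 2),
        abs_of_nonneg (by positivity : 0 ≤ u ^ 2 + x ^ 2), div_le_iff₀ (by positivity)]
      have : u * |x| ≤ u ^ 2 + x ^ 2 := by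
        nlinarith [sq_nonneg (u - |x|), sq_abs x, mul_nonneg hu.le (abs_nonneg x)]
      nlinarith
    have hjoint : Integrable (Function.uncurry fun (x s : ℝ) => x ^ 2 / (x ^ 2 + s ^ 2))
        (μ.prod (volume.restrict (Set.Ioc 1 V))) := by
      refine Integrable.of_bound (Measurable.aestronglyMeasurable (by fun_prop)) 1
        (Eventually.of_forall fun p => ?_)
      simp only [Function.uncurry]
      rw [Real.norm_of_nonneg (by positivity)]
      exact div_le_one_of_le₀ (by nlinarith [sq_nonneg p.2]) (by positivity)
    have hswap : ∫ x, (∫ s in (1 : ℝ)..V, x ^ 2 / (x ^ 2 + s ^ 2)) ∂μ =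
        ∫ s in (1 : ℝ)..V, (∫ x, x ^ 2 / (x ^ 2 + s ^ 2) ∂μ) := by
      simp_rw [intervalIntegral.integral_of_le hV]
      exact integral_integral_swap hjoint
    have hi1 : Integrable (fun x : ℝ => ∫ s in (1 : ℝ)..V, x ^ 2 / (x ^ 2 + s ^ 2)) μ := by
      simp_rw [intervalIntegral.integral_of_le hV]
      exact hjoint.integral_prod_left
    have hi2 : IntervalIntegrable (fun s => ∫ x, x ^ 2 / (x ^ 2 + s ^ 2) ∂μ) volume 1 V := by
      rw [intervalIntegrable_iff_integrableOn_Ioc_of_le hV]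
      exact hjoint.integral_prod_right
    have hne : ∀ s ∈ Set.uIcc 1 V, s ≠ 0 := by
      intro s hs
      rw [Set.uIcc_of_le hV] at hs
      linarith [hs.1]
    have hi3 : IntervalIntegrable (fun s : ℝ => A / s + 2 * C / s ^ 2) volume 1 V := by
      refine ContinuousOn.intervalIntegrable fun s hs => ?_
      have := hne s hs
      exact ContinuousAt.continuousWithinAt (by fun_prop (disch := positivity))
    have hint : ∫ s in (1 : ℝ)..V, (A / s + 2 * C / s ^ 2) =
        A * Real.log V + 2 * C * (1 - V⁻¹) := by
      have hd : ∀ s ∈ Set.uIcc 1 V, HasDerivAt (fun s => A * Real.log s + 2 * C * (1 - s⁻¹))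
          (A / s + 2 * C / s ^ 2) s := by
        intro s hs
        have hs0 := hne s hs
        have h1 := ((Real.hasDerivAt_log hs0).const_mul A).add
          (((hasDerivAt_inv hs0).const_sub 1).const_mul (2 * C))
        refine h1.congr_deriv ?_
        field_simp
      rw [intervalIntegral.integral_eq_sub_of_hasDerivAt hd hi3]
      simp
    have hmono : ∫ s in (1 : ℝ)..V, (∫ x, x ^ 2 / (x ^ 2 + s ^ 2) ∂μ) ≤
        A * Real.log V + 2 * C := by
      have h1 := intervalIntegral.integral_mono_on hV hi2 hi3
        fun s hs => ha s (by linarith [hs.1])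
      rw [hint] at h1
      have : 0 ≤ 2 * C * V⁻¹ := by positivity
      linarith
    have hkernel : |(∫ x, V ^ 2 * x / (V ^ 2 + x ^ 2) ∂μ) -
        ∫ x, (1 : ℝ) ^ 2 * x / ((1 : ℝ) ^ 2 + x ^ 2) ∂μ| ≤
        2 / Real.pi * (∫ s in (1 : ℝ)..V, (∫ x, x ^ 2 / (x ^ 2 + s ^ 2) ∂μ)) +
        2 * (V * ∫ x, x ^ 2 / (x ^ 2 + V ^ 2) ∂μ) +
        2 * (1 * ∫ x, x ^ 2 / (x ^ 2 + (1 : ℝ) ^ 2) ∂μ) := by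
      have hiV := ((integrable_sq_div μ V).const_mul V).const_mul 2
      have hi1' := ((integrable_sq_div μ 1).const_mul 1).const_mul 2
      rw [← hswap, ← integral_sub (hk V hV0) (hk 1 one_pos), ← Real.norm_eq_abs]
      refine (norm_integral_le_of_norm_le (((hi1.const_mul (2 / Real.pi)).add hiV).add hi1')
        (Eventually.of_forall fun x => abs_kernel_sub_le one_pos hV)).trans ?_
      simp only [Pi.add_apply]
      have hi12 : Integrable (fun x : ℝ => 2 / Real.pi *
          (∫ s in (1 : ℝ)..V, x ^ 2 / (x ^ 2 + s ^ 2)) + 2 * (V * (x ^ 2 / (x ^ 2 + V ^ 2)))) μ :=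
        (hi1.const_mul (2 / Real.pi)).add hiV
      rw [integral_add hi12 hi1', integral_add (hi1.const_mul (2 / Real.pi)) hiV]
      simp only [integral_const_mul, le_refl]
    have hbd : ∀ u : ℝ, 1 ≤ u → u * ∫ x, x ^ 2 / (x ^ 2 + u ^ 2) ∂μ ≤ |A| + 2 * C := by
      intro u hu
      have hu0 : 0 < u := by linarith
      have h1 := mul_le_mul_of_nonneg_left (ha u hu0) hu0.le
      have h2 : u * (A / u + 2 * C / u ^ 2) = A + 2 * C / u := by field_simp
      have h3 : 2 * C / u ≤ 2 * C := div_le_self (by positivity) hu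
      rw [h2] at h1
      linarith [le_abs_self A]
    have hMV := hM V hV
    have hM1 := hM 1 le_rfl
    rw [Real.log_one, mul_zero, sub_zero] at hM1
    have hbV := hbd V hV
    have hb1 := hbd 1 le_rfl
    have hlogV : |b| * Real.log V = |b * Real.log V| := by
      rw [abs_mul, abs_of_nonneg (Real.log_nonneg hV)]
    have hfin : |b * Real.log V| ≤ 2 * M + |(∫ x, V ^ 2 * x / (V ^ 2 + x ^ 2) ∂μ) -
        ∫ x, (1 : ℝ) ^ 2 * x / ((1 : ℝ) ^ 2 + x ^ 2) ∂μ| := by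
      rw [abs_le] at hMV hM1
      have h1 := le_abs_self ((∫ x, V ^ 2 * x / (V ^ 2 + x ^ 2) ∂μ) -
        ∫ x, (1 : ℝ) ^ 2 * x / ((1 : ℝ) ^ 2 + x ^ 2) ∂μ)
      have h2 := neg_abs_le ((∫ x, V ^ 2 * x / (V ^ 2 + x ^ 2) ∂μ) -
        ∫ x, (1 : ℝ) ^ 2 * x / ((1 : ℝ) ^ 2 + x ^ 2) ∂μ)
      rw [abs_le]; constructor <;> linarith
    have hpm := mul_le_mul_of_nonneg_left hmono (by positivity : 0 ≤ 2 / Real.pi)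
    rw [hlogV, hK]
    linarith
  by_contra! hlt
  have hx : 0 < |b| - 2 / Real.pi * A := by linarith
  -- At `V = exp L` the gap between the two slopes, times `L`, exceeds `K`.
  set L := |K| / (|b| - 2 / Real.pi * A) + 1 with hL
  have hL0 : 0 ≤ L := by positivity
  have h1 := key (Real.exp L) (Real.one_le_exp hL0)
  rw [Real.log_exp] at h1
  have h2 : (|b| - 2 / Real.pi * A) * L = |K| + (|b| - 2 / Real.pi * A) := by
    rw [hL, mul_add, mul_div_cancel₀ _ hx.ne', mul_one]
  linarith [le_abs_self K]

/-! ### Normalised sums, stability and the main theorem. -/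

lemma tendsto_charFun_nhdsGT_zero (μ : Measure ℝ) [IsProbabilityMeasure μ] :
    Tendsto (charFun μ) (𝓝[>] 0) (𝓝 1) := by
  have h : Continuous (charFun μ) := by fun_prop
  simpa using (h.tendsto 0).mono_left nhdsWithin_le_nhds

lemma hasLogExpansion_iff (φ : ℝ → ℂ) (b κ l : ℝ) : HasLogExpansion φ b κ l ↔
    (fun t : ℝ => φ t - (1 + expo (-((κ : ℂ) - Complex.I * l)) b t)) =o[𝓝[>] 0]
      (fun t : ℝ => t) := by
  have : (fun t : ℝ => φ t - (1 - ((κ : ℂ) - Complex.I * l) * t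
      - Complex.I * b * t * (Real.log t : ℂ))) =
      fun t : ℝ => φ t - (1 + expo (-((κ : ℂ) - Complex.I * l)) b t) := by
    funext t; simp only [expo]; ring
  rw [HasLogExpansion, this]

lemma norm_exp_expo (c : ℂ) (b t : ℝ) : ‖Complex.exp (expo c b t)‖ = Real.exp (c.re * t) := by
  rw [Complex.norm_exp]; congr 1; simp [expo]

lemma charFun_map_normalized_sum {Ω : Type*} [MeasurableSpace Ω] {P : Measure Ω}
    [IsProbabilityMeasure P] {X : ℕ → Ω → ℝ} (hindep : iIndepFun X P)
    (hident : ∀ i, IdentDistrib (X i) (X 0) P P) (b : ℝ) (n : ℕ) (t : ℝ) :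
    charFun (P.map fun ω => (∑ i ∈ Finset.range n, X i ω) / n - b * Real.log n) t =
      charFun (P.map (X 0)) (t / n) ^ n *
        Complex.exp (-(Complex.I * t * b * (Real.log n : ℂ))) := by
  have mX n := (hident n).aemeasurable_fst
  have hs : AEMeasurable (fun ω => ∑ i ∈ Finset.range n, X i ω) P :=
    Finset.aemeasurable_fun_sum _ fun _ _ => mX _
  have h1 : (P.map fun ω => (∑ i ∈ Finset.range n, X i ω) / n - b * Real.log n) =
      (P.map fun ω => (n : ℝ)⁻¹ * ∑ i ∈ Finset.range n, X i ω).map (· + -(b * Real.log n)) := by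
    rw [AEMeasurable.map_map_of_aemeasurable (by fun_prop) (hs.const_mul _)]
    congr 1; funext ω; simp only [Function.comp]; ring
  rw [h1, charFun_map_add_const, charFun_map_mul_comp hs,
    (hindep.restrict _).charFun_map_fun_finsetSum_eq_prod (fun _ _ => mX _)]
  simp only [fun i => (hident i).map_eq, Finset.prod_const, Finset.card_range, Pi.pow_apply]
  congr 2
  · rw [inv_mul_eq_div]
  · simp; ring

/-- A measure whose characteristic function is `exp (expo c b)` on the positive half-line, with
`c` of negative real part, is `1`-stable. -/
lemma isStableLaw_one {ν : Measure ℝ} [IsProbabilityMeasure ν] {c : ℂ} {b : ℝ} (hc : c.re < 0)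
    (h : ∀ t : ℝ, 0 < t → charFun ν t = Complex.exp (expo c b t)) : IsStableLaw 1 ν := by
  -- The shift `b n log n` is the one in `expo_mul`. Equality of characteristic functions at
  -- negative arguments follows by conjugation.
  refine ⟨one_pos, one_le_two, inferInstance, ?_, fun n => b * (n * Real.log n), fun n hn => ?_⟩
  · rintro ⟨a, ha⟩
    have h1 : ν.map (fun x : ℝ => x) = ν.map fun _ => a := Measure.map_congr ha
    rw [Measure.map_id', Measure.map_const, measure_univ, one_smul] at h1
    have h2 := congrArg norm (h 1 one_pos)
    rw [h1, charFun_dirac, norm_exp_expo] at h2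
    have h3 : (1 : ℝ) = Real.exp (c.re * 1) := by
      rw [← h2]
      exact (Complex.norm_exp_ofReal_mul_I _).symm
    have h4 : Real.exp (c.re * 1) < Real.exp 0 := Real.exp_lt_exp.2 (by linarith)
    rw [Real.exp_zero] at h4
    linarith
  · have hn0 : (0 : ℝ) < n := by exact_mod_cast hn
    have hfun : (fun x : ℝ => (n : ℝ) ^ (1 / (1 : ℝ)) * x + b * (n * Real.log n)) =
        (· + b * (n * Real.log n)) ∘ ((n : ℝ) * ·) := by
      funext x; simp
    have hI1 : IsProbabilityMeasure (ν.map ((n : ℝ) * ·)) :=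
      Measure.isProbabilityMeasure_map (by fun_prop)
    have hI2 : IsProbabilityMeasure
        ((ν.map ((n : ℝ) * ·)).map (· + b * (n * Real.log n))) :=
      Measure.isProbabilityMeasure_map (by fun_prop)
    have hI3 : IsProbabilityMeasure
        ((Measure.pi (fun _ : Fin n => ν)).map (fun x => ∑ i, x i)) :=
      Measure.isProbabilityMeasure_map (by fun_prop)
    rw [hfun, ← Measure.map_map (by fun_prop) (by fun_prop)]
    have hpos : ∀ t : ℝ, 0 < t →
        charFun ((Measure.pi (fun _ : Fin n => ν)).map (fun x => ∑ i, x i)) t =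
        charFun ((ν.map ((n : ℝ) * ·)).map (· + b * (n * Real.log n))) t := by
      intro t ht
      rw [charFun_map_sum_pi_eq_prod, charFun_map_add_const, charFun_map_mul]
      simp only [Finset.prod_const, Finset.card_univ, Fintype.card_fin, Pi.pow_apply]
      rw [h t ht, h _ (mul_pos hn0 ht), expo_mul c b hn0 ht, ← Complex.exp_nat_mul,
        ← Complex.exp_add]
      congr 1
      simp
      ring
    refine Measure.ext_of_charFun (funext fun t => ?_)
    rcases lt_trichotomy t 0 with ht | rfl | ht
    · have := congrArg (starRingEnd ℂ) (hpos (-t) (by linarith))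
      rwa [← charFun_neg, ← charFun_neg, neg_neg] at this
    · simp
    · exact hpos t ht

/-- The scaling relation satisfied by a weak limit of the normalised sums. -/
lemma scaling_of_tendsto {φ F : ℝ → ℂ} {b : ℝ}
    (h : ∀ t : ℝ, Tendsto (fun n : ℕ => φ (t / n) ^ n *
      Complex.exp (-(Complex.I * t * b * (Real.log n : ℂ)))) atTop (𝓝 (F t)))
    (k : ℕ) (hk : 1 ≤ k) (t : ℝ) :
    F (k * t) = F t ^ k * Complex.exp (-(Complex.I * (k * t) * b * (Real.log k : ℂ))) := by
  -- Along the indices `k n`, `(k t)/(k n) = t/n`, so the power becomes a `k`-th power and `log (k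
  -- n)` splits.
  have hsub : Tendsto (fun n : ℕ => k * n) atTop atTop :=
    tendsto_id.const_mul_atTop' (by omega)
  have h1 := (h (k * t)).comp hsub
  have h2 := ((h t).pow k).mul_const
    (Complex.exp (-(Complex.I * (k * t) * b * (Real.log k : ℂ))))
  refine tendsto_nhds_unique h1 (h2.congr' ?_)
  filter_upwards [eventually_gt_atTop 0] with n hn
  have hn0 : (n : ℝ) ≠ 0 := by exact_mod_cast hn.ne'
  have hk0 : (k : ℝ) ≠ 0 := by exact_mod_cast (by omega : k ≠ 0)
  have h3 : (k : ℝ) * t / ((k * n : ℕ) : ℝ) = t / n := by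
    push_cast; rw [mul_div_mul_left _ _ hk0]
  have h4 : Real.log ((k * n : ℕ) : ℝ) = Real.log k + Real.log n := by
    push_cast; exact Real.log_mul hk0 hn0
  simp only [Function.comp]
  rw [h3, h4, mul_pow, ← pow_mul, mul_comm n k, mul_assoc, ← Complex.exp_nat_mul,
    ← Complex.exp_add]
  congr 2
  push_cast
  ring

end LogStable

open LogStable in
theorem mainTheorem2 {Ω : Type u} [MeasurableSpace Ω] (P : Measure Ω)
    [IsProbabilityMeasure P] (X : ℕ → Ω → ℝ) (hindep : iIndepFun X P)
    (hident : ∀ i, IdentDistrib (X i) (X 0) P P) (b : ℝ) :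
    ((∃ (Ω' : Type v) (_ : MeasurableSpace Ω') (P' : Measure Ω') (_ : IsProbabilityMeasure P')
        (Z : Ω' → ℝ), NonDegenerate Z P' ∧
          TendstoInDistribution
            (fun (n : ℕ) ω => (∑ i ∈ Finset.range n, X i ω) / n - b * Real.log n)
            atTop Z (fun _ => P) P') ↔
      ∃ κ l : ℝ, 0 < κ ∧ HasLogExpansion (charFun (P.map (X 0))) b κ l) ∧
    ∀ κ l : ℝ, 0 < κ → HasLogExpansion (charFun (P.map (X 0))) b κ l →
      |b| ≤ 2 * κ / Real.pi ∧
      ∀ (Ω' : Type v) [MeasurableSpace Ω'] (P' : Measure Ω') [IsProbabilityMeasure P']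
        (Z : Ω' → ℝ),
        TendstoInDistribution
            (fun (n : ℕ) ω => (∑ i ∈ Finset.range n, X i ω) / n - b * Real.log n)
            atTop Z (fun _ => P) P' →
          IsStableLaw 1 (P'.map Z) ∧
          ∀ t : ℝ, 0 < t → charFun (P'.map Z) t =
            Complex.exp (-((κ : ℂ) - Complex.I * l) * t - Complex.I * b * t * (Real.log t : ℂ)) := by
  have mX n := (hident n).aemeasurable_fst
  have hμ : IsProbabilityMeasure (P.map (X 0)) := Measure.isProbabilityMeasure_map (mX 0)
  have mS : ∀ n : ℕ, AEMeasurable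
      (fun ω => (∑ i ∈ Finset.range n, X i ω) / n - b * Real.log n) P := fun n =>
    ((Finset.aemeasurable_fun_sum _ fun _ _ => mX _).div_const _).sub_const _
  set S : ℕ → ProbabilityMeasure ℝ := fun n =>
    ⟨P.map fun ω => (∑ i ∈ Finset.range n, X i ω) / n - b * Real.log n,
      Measure.isProbabilityMeasure_map (mS n)⟩ with hS
  have hSchar : ∀ n t, charFun (S n : Measure ℝ) t = charFun (P.map (X 0)) (t / n) ^ n *
      Complex.exp (-(Complex.I * t * b * (Real.log n : ℂ))) :=
    fun n t => charFun_map_normalized_sum hindep hident b n t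
  have hφ1 := tendsto_charFun_nhdsGT_zero (P.map (X 0))
  have hlim : ∀ κ l : ℝ, HasLogExpansion (charFun (P.map (X 0))) b κ l → ∀ t : ℝ, 0 < t →
      Tendsto (fun n => charFun (S n : Measure ℝ) t) atTop
        (𝓝 (Complex.exp (expo (-((κ : ℂ) - Complex.I * l)) b t))) := by
    intro κ l h t ht
    have h1 := log_sub_isLittleO_of_sub_one_add hφ1 (expo_sq_isLittleO _ b)
      ((hasLogExpansion_iff _ _ _ _).1 h)
    exact (tendsto_pow_mul_exp hφ1 h1 ht).congr fun n => (hSchar n t).symm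
  refine ⟨⟨?_, ?_⟩, fun κ l hκ h => ⟨abs_le_of_hasLogExpansion _ h, ?_⟩⟩
  · rintro ⟨Ω', _, P', _, Z, hZ, hconv⟩
    have hν : IsProbabilityMeasure (P'.map Z) :=
      Measure.isProbabilityMeasure_map hconv.aemeasurable_limit
    set ν : ProbabilityMeasure ℝ := ⟨P'.map Z, hν⟩ with hνdef
    have hw : Tendsto S atTop (𝓝 ν) := hconv.tendsto
    have hp : ∀ t : ℝ, Tendsto (fun n : ℕ => charFun (P.map (X 0)) (t / n) ^ n *
        Complex.exp (-(Complex.I * t * b * (Real.log n : ℂ)))) atTop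
        (𝓝 (charFun (P'.map Z) t)) := fun t =>
      (ProbabilityMeasure.tendsto_iff_tendsto_charFun.1 hw t).congr fun n => hSchar n t
    obtain ⟨c, hc⟩ := eq_exp_expo_of_scaling (F := charFun (P'.map Z)) (by fun_prop) (by simp)
      (scaling_of_tendsto hp)
    -- Otherwise the characteristic function has modulus `1` everywhere and `Z` is almost surely
    -- constant.
    have hc0 : c.re < 0 := by
      by_contra! hge
      apply hZ
      have hone : ∀ t : ℝ, 0 < t → ‖charFun (P'.map Z) t‖ = 1 := by
        intro t ht
        refine le_antisymm (norm_charFun_le_one t) ?_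
        rw [hc t ht, norm_exp_expo]
        exact Real.one_le_exp (by positivity)
      obtain ⟨a, ha⟩ := exists_ae_eq_of_norm_charFun_eq_one (P'.map Z) fun t => by
        rcases lt_trichotomy t 0 with ht | rfl | ht
        · rw [← neg_neg t, charFun_neg, RCLike.norm_conj]; exact hone _ (by linarith)
        · simp
        · exact hone t ht
      exact ⟨a, ae_of_ae_map hconv.aemeasurable_limit ha⟩
    have hcexp : c = -(((-c.re : ℝ) : ℂ) - Complex.I * (c.im : ℝ)) := by
      apply Complex.ext <;> simp
    have hexp : ∀ t ∈ Set.Icc (0 : ℝ) 1, charFun (P'.map Z) t = Complex.exp (expo c b t) := by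
      intro t ht
      rcases ht.1.eq_or_lt with rfl | h0
      · simp
      · exact hc t h0
    have hunif : TendstoUniformlyOn (fun (n : ℕ) (t : ℝ) => charFun (P.map (X 0)) (t / n) ^ n *
        Complex.exp (-(Complex.I * t * b * (Real.log n : ℂ))))
        (fun t => Complex.exp (expo c b t)) atTop (Set.Icc 0 1) :=
      ((tendstoUniformlyOn_charFun hw 0 1).congr
        (Eventually.of_forall fun n t _ => hSchar n t)).congr_right hexp
    refine ⟨-c.re, c.im, by linarith, ?_⟩
    rw [hasLogExpansion_iff, ← hcexp]
    exact sub_one_add_isLittleO_of_log_sub hφ1 (tendsto_expo_nhdsGT c b) (expo_sq_isLittleO c b)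
      (log_sub_expo_isLittleO (by fun_prop) (by simp) hunif)
  · rintro ⟨κ, l, hκ, h⟩
    set c : ℂ := -((κ : ℂ) - Complex.I * l) with hcdef
    -- Conjugate symmetry extends the limit to negative arguments; Lévy's theorem needs it on the
    -- whole line and continuous at `0`.
    set f : ℝ → ℂ := fun t => if 0 ≤ t then Complex.exp (expo c b t) else
      (starRingEnd ℂ) (Complex.exp (expo c b (-t))) with hf
    have hfc : Continuous f := by
      have he := continuous_expo c b
      refine Continuous.if_le (by fun_prop) ?_ continuous_const continuous_id ?_
      · exact Complex.continuous_conj.comp (by fun_prop)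
      · rintro t rfl; simp
    have hft : ∀ t, Tendsto (fun n => charFun (S n : Measure ℝ) t) atTop (𝓝 (f t)) := by
      intro t
      rcases lt_trichotomy t 0 with ht | rfl | ht
      · have h1 := (Complex.continuous_conj.tendsto _).comp (hlim κ l h (-t) (by linarith))
        simp only [hf, not_le.2 ht, if_false]
        refine h1.congr fun n => ?_
        simp only [Function.comp]
        rw [← charFun_neg, neg_neg]
      · simp [hf]
      · simpa only [hf, ht.le, if_true] using hlim κ l h t ht
    obtain ⟨ν, hνf, hν⟩ := exists_tendsto_of_tendsto_charFun hfc.continuousAt hft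
    have hνc : ∀ t : ℝ, 0 < t → charFun (ν : Measure ℝ) t = Complex.exp (expo c b t) := by
      intro t ht
      rw [hνf]; simp only [hf, ht.le, if_true]
    have hst : IsStableLaw 1 (ν : Measure ℝ) := isStableLaw_one (by simp [hcdef, hκ]) hνc
    -- The limit law lives on `ℝ`, whereas the sample space must lie in `Type v`; `ULift` moves it
    -- there.
    have hup : Measurable (ULift.up.{v} : ℝ → ULift.{v} ℝ) := measurable_up
    have hmap : ((ν : Measure ℝ).map (ULift.up.{v})).map ULift.down = (ν : Measure ℝ) := by
      rw [Measure.map_map measurable_down measurable_up]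
      exact Measure.map_id
    have hPu : IsProbabilityMeasure ((ν : Measure ℝ).map (ULift.up.{v})) :=
      Measure.isProbabilityMeasure_map hup.aemeasurable
    refine ⟨ULift.{v} ℝ, inferInstance, (ν : Measure ℝ).map ULift.up, hPu, ULift.down, ?_, ?_⟩
    · rintro ⟨a, ha⟩
      exact hst.2.2.2.1 ⟨a, ae_of_ae_map hup.aemeasurable ha⟩
    · refine ⟨mS, measurable_down.aemeasurable, ?_⟩
      have hlaw : (⟨((ν : Measure ℝ).map (ULift.up.{v})).map ULift.down,
          Measure.isProbabilityMeasure_map measurable_down.aemeasurable⟩ : ProbabilityMeasure ℝ)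
          = ν := Subtype.ext hmap
      rw [hlaw]
      exact hν
  · intro Ω' _ P' _ Z hconv
    have hν : IsProbabilityMeasure (P'.map Z) :=
      Measure.isProbabilityMeasure_map hconv.aemeasurable_limit
    have hw : Tendsto S atTop (𝓝 ⟨P'.map Z, hν⟩) := hconv.tendsto
    have hc : ∀ t : ℝ, 0 < t → charFun (P'.map Z) t =
        Complex.exp (expo (-((κ : ℂ) - Complex.I * l)) b t) := fun t ht =>
      tendsto_nhds_unique (ProbabilityMeasure.tendsto_iff_tendsto_charFun.1 hw t)
        (hlim κ l h t ht)
    exact ⟨isStableLaw_one (by simpa using hκ) hc, hc⟩
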